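/- Let $\Omega\subset\mathbb R^2$ be a polygonal domain (nonempty, connected, bounded, equal to the interior of its closure) with a conforming triangulation $\mathcal T_h$ of $\overline\Omega$. Let $\mathbb D:\overline\Omega\to\mathbb R^{2\times2}$, $\mathbf b:\overline\Omega\to\mathbb R^2$, $c:\overline\Omega\to\mathbb R$ be continuous, with $\mathbf b\in C^1(\Omega)$, and suppose that for all $\mathbf x\in\Omega$ the matrix $\mathbb D(\mathbf x)$ is symmetric positive definite, $c(\mathbf x)-\tfrac12\nabla\cdot\mathbf b(\mathbf x)\ge0$ and $c(\mathbf x)\ge 0$. For $f\in C(\overline\Omega)$ and a function $g$ on $\partial\Omega$, consider the P1 finite element scheme for $-\nabla\cdot(\mathbb D\nabla u)+\mathbf b\cdot\nabla u+cu=f$ in $\Omega$, $u=g$ on $\partial\Omega$: find a continuous function $u^h$ on $\overline\Omega$, affine on each $K\in\mathcal T_h$, with $u^h(\mathbf a)=g(\mathbf a)$ at every mesh vertex $\mathbf a\in\partial\Omega$, such that $$\sum_{K\in\mathcal T_h}|K|(\nabla v^h)^T\mathbb D_K\nabla u^h+\sum_{K\in\mathcal T_h}\int_K v^h(\mathbf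 b\cdot\nabla u^h)\,d\mathbf x+\sum_{K\in\mathcal T_h}\int_K c\,u^hv^h\,d\mathbf x=\sum_{K\in\mathcal T_h}\int_K f v^h\,d\mathbf x$$ for all continuous $v^h$ that are affine on each $K$ and vanish at the mesh vertices on $\partial\Omega$. Here $\mathbb D_K=\frac1{|K|}\int_K\mathbb D\,d\mathbf x$. Let $e_{ij}$ be a mesh edge joining an interior vertex $\mathbf a_i\in\Omega$ to another vertex $\mathbf a_j$, and let $K,K'$ be the two elements that share it. Let $\alpha_{ij,\mathbb D_K^{-1}}\in(0,\pi)$ be the angle of $K$ facing $e_{ij}$, measured in the metric (inner product) $\mathbf x^T\mathbb D_K^{-1}\mathbf y$, and define $\alpha_{ij,\mathbb D_{K'}^{-1}}$ in the same way. Let $h_j^K$ be the height of $K$ over the side opposite to $\mathbf a_j$, let $\|\mathbf b\|_{\infty,K}=\max_K\|\mathbf b\|$ (Euclidean norm) and $\|c\|_{\infty,K}=\max_K c$, and put $$C(K,K',j)=\frac{|K|\,\|\mathbf b\|_{\infty,K}}{3h_j^K}+\frac{|K|\,\|c\|_{\infty,K}}{12}+\frac{|K'|\,\|\mathbf b\|_{\infty,K'}}{3h_j^{K'}}+\frac{|K'|\,\|c\|_{\infty,K'}}{12}.$$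 With $\operatorname{arccot}:\mathbb R\to(0,\pi)$, consider the condition $$0<\frac12\Big[\alpha_{ij,\mathbb D_K^{-1}}+\alpha_{ij,\mathbb D_{K'}^{-1}}+\operatorname{arccot}\Big(\sqrt{\tfrac{\det\mathbb D_{K'}}{\det\mathbb D_K}}\cot\alpha_{ij,\mathbb D_{K'}^{-1}}-\tfrac{2C(K,K',j)}{\sqrt{\det\mathbb D_K}}\Big)+\operatorname{arccot}\Big(\sqrt{\tfrac{\det\mathbb D_K}{\det\mathbb D_{K'}}}\cot\alpha_{ij,\mathbb D_K^{-1}}-\tfrac{2C(K,K',j)}{\sqrt{\det\mathbb D_{K'}}}\Big)\Big]\le\pi.\tag{$*$}$$ (a) If $(*)$ holds for every such edge (in both orders $(i,j)$ and $(j,i)$ when both endpoints are interior vertices), then for all $f\in C(\overline\Omega)$ and all $g$ the scheme has exactly one solution $u^h$ on $\overline\Omega$, and the scheme satisfies the discrete maximum principle: if $f\le0$ in $\Omega$, then $\max_{\overline\Omega}u^h\le\max\{0,\max_{\partial\Omega}u^h\}$, and if $f\ge0$ in $\Omega$, then $\min_{\overline\Omega}u^h\ge\min\{0,\min_{\partial\Omega}u^h\}$.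 (b) If $\mathbb D=I$, $\mathbf b=0$ and $c=0$ in $\Omega$, then for every such edge $(*)$ is equivalent to the Delaunay condition that the sum of the two (Euclidean) angles facing the edge is at most $\pi$. -/

import Mathlib

namespace P1FEM

open MeasureTheory Set

/-- The Euclidean plane. -/
abbrev Plane : Type := EuclideanSpace ℝ (Fin 2)

/-- A conforming simplicial mesh of (the closure of) a planar domain `Ω`: finitely many
nondegenerate triangles, each given by its set of vertices, that cover the closure of `Ω`, any two
of them meeting exactly in the (possibly empty) common face spanned by their common vertices. -/
structure Triangulation (Ω : Set Plane) where
  /-- the elements, each given by its set of three vertices -/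
  elems : Finset (Finset Plane)
  card_eq : ∀ K ∈ elems, K.card = 3
  indep : ∀ K ∈ elems, AffineIndependent ℝ (fun a : K => (a : Plane))
  cover : (⋃ K ∈ elems, convexHull ℝ (K : Set Plane)) = closure Ω
  conforming : ∀ K ∈ elems, ∀ K' ∈ elems,
    convexHull ℝ (K : Set Plane) ∩ convexHull ℝ (K' : Set Plane)
      = convexHull ℝ ((K : Set Plane) ∩ (K' : Set Plane))

/-- The vertices of the mesh. -/
def Triangulation.vertices {Ω : Set Plane} (T : Triangulation Ω) : Set Plane :=
  {a | ∃ K ∈ T.elems, a ∈ K}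

open Classical in
/-- The edge with end points `i` and `j`, where `i` is an interior vertex (and `j` is any vertex),
is shared by the two different elements with vertices `i, j, k` and `i, j, k'`. -/
def Triangulation.InternalEdge {Ω : Set Plane} (T : Triangulation Ω) (i j k k' : Plane) : Prop :=
  i ∈ Ω ∧ k ≠ k' ∧ ({i, j, k} : Finset Plane) ∈ T.elems ∧ ({i, j, k'} : Finset Plane) ∈ T.elems

/-- The linear finite element space: continuous functions on the closure of `Ω` that are affine on
each element (the values outside the closure of `Ω` are irrelevant). -/
def Triangulation.IsP1 {Ω : Set Plane} (T : Triangulation Ω) (u : Plane → ℝ) : Prop :=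
  ContinuousOn u (closure Ω) ∧
    ∀ K ∈ T.elems, ∃ l : Plane →ᵃ[ℝ] ℝ, EqOn u l (convexHull ℝ (K : Set Plane))

/-- The divergence of a vector field. -/
noncomputable def div (b : Plane → Plane) (x : Plane) : ℝ :=
  ∑ r : Fin 2, (fderiv ℝ b x (EuclideanSpace.single r 1)) r

/-- The bilinear form `xᵀ M y`. -/
def form (M : Matrix (Fin 2) (Fin 2) ℝ) (x y : Plane) : ℝ :=
  x.ofLp ⬝ᵥ M.mulVec y.ofLp

/-- The area `|K|`. -/
noncomputable def area (K : Set Plane) : ℝ := volume.real K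

/-- The integral average of the diffusion matrix over `K` (entry by entry). -/
noncomputable def avg (D : Plane → Matrix (Fin 2) (Fin 2) ℝ) (K : Set Plane) :
    Matrix (Fin 2) (Fin 2) ℝ :=
  Matrix.of fun r s => ⨍ x in K, D x r s

/-- The constant gradient on the triangle with vertex set `K` of a function that is affine there:
its gradient at the barycentre, an interior point of the triangle. -/
noncomputable def elemGrad (K : Finset Plane) (u : Plane → ℝ) : Plane :=
  gradient u (K.centroid ℝ id)

/-- `u` solves the linear finite element scheme on the mesh `T` for
`-∇ · (D ∇u) + b · ∇u + c u = f` in `Ω`, `u = g` on `∂Ω`: it is a linear finite element function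
that takes the values of `g` at the boundary vertices and satisfies the discrete equation for all
test functions in the span of the nodal basis functions of the interior vertices, that is, for all
linear finite element functions that vanish at the boundary vertices. -/
def IsSolution {Ω : Set Plane} (T : Triangulation Ω) (D : Plane → Matrix (Fin 2) (Fin 2) ℝ)
    (b : Plane → Plane) (c f g : Plane → ℝ) (u : Plane → ℝ) : Prop :=
  T.IsP1 u ∧ (∀ a ∈ T.vertices, a ∈ frontier Ω → u a = g a) ∧
    ∀ v : Plane → ℝ, T.IsP1 v → (∀ a ∈ T.vertices, a ∈ frontier Ω → v a = 0) →
      (∑ K ∈ T.elems, area (convexHull ℝ (K : Set Plane)) *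
          form (avg D (convexHull ℝ (K : Set Plane))) (elemGrad K v) (elemGrad K u))
        + (∑ K ∈ T.elems, ∫ x in convexHull ℝ (K : Set Plane),
            v x * inner ℝ (b x) (elemGrad K u))
        + (∑ K ∈ T.elems, ∫ x in convexHull ℝ (K : Set Plane), c x * u x * v x)
      = ∑ K ∈ T.elems, ∫ x in convexHull ℝ (K : Set Plane), f x * v x

/-- The scheme is uniquely solvable for all continuous `f` and all boundary data. -/
def UniquelySolvable {Ω : Set Plane} (T : Triangulation Ω)
    (D : Plane → Matrix (Fin 2) (Fin 2) ℝ) (b : Plane → Plane) (c : Plane → ℝ) : Prop :=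
  ∀ f g : Plane → ℝ, ContinuousOn f (closure Ω) →
    ∃ u, IsSolution T D b c f g u ∧
      ∀ w, IsSolution T D b c f g w → EqOn w u (closure Ω)

/-- The discrete maximum principle: for all data, a nonpositive right-hand side implies
`max_{closure Ω} u ≤ max (0, max_{∂Ω} u)` for the finite element solution `u`, and a nonnegative
right-hand side implies `min_{closure Ω} u ≥ min (0, min_{∂Ω} u)`. -/
def SatisfiesDMP {Ω : Set Plane} (T : Triangulation Ω)
    (D : Plane → Matrix (Fin 2) (Fin 2) ℝ) (b : Plane → Plane) (c : Plane → ℝ) : Prop :=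
  ∀ f g u : Plane → ℝ, ContinuousOn f (closure Ω) → IsSolution T D b c f g u →
    ((∀ x ∈ Ω, f x ≤ 0) → ∀ x ∈ closure Ω, ∃ y ∈ frontier Ω, u x ≤ max 0 (u y)) ∧
    ((∀ x ∈ Ω, 0 ≤ f x) → ∀ x ∈ closure Ω, ∃ y ∈ frontier Ω, min 0 (u y) ≤ u x)

/-- The closed triangle with vertices `i, j, k`. -/
def tri (i j k : Plane) : Set Plane := convexHull ℝ {i, j, k}

/-- The angle between the vectors `x` and `y` in the metric given by the matrix `M`. -/
noncomputable def metricAngle (M : Matrix (Fin 2) (Fin 2) ℝ) (x y : Plane) : ℝ :=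
  Real.arccos (form M x y / (√(form M x x) * √(form M y y)))

/-- The angle of the triangle `K` with vertices `i, j, k` that faces the edge from `i` to `j`,
measured in the metric `D_K⁻¹`, with `D_K` the average of `D` over `K`. -/
noncomputable def oppAngle (D : Plane → Matrix (Fin 2) (Fin 2) ℝ) (i j k : Plane) : ℝ :=
  metricAngle (avg D (tri i j k))⁻¹ (i - k) (j - k)

/-- `arccot`, with values in `(0, π)`. -/
noncomputable def arccot (t : ℝ) : ℝ := Real.pi / 2 - Real.arctan t

/-- The height of the triangle with vertices `i, j, k` over the side opposite to `j`. -/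
noncomputable def height (i j k : Plane) : ℝ :=
  Metric.infDist j (affineSpan ℝ {i, k} : Set Plane)

/-- The contribution
`|K| ‖b‖_{∞,K} / (h_j^K (d+1)) + |K| ‖c‖_{∞,K} / ((d+1)(d+2))`, `d = 2`,
of the element `K` with vertices `i, j, k`, where the norms are maxima over `K`. -/
noncomputable def perturbation (b : Plane → Plane) (c : Plane → ℝ) (i j k : Plane) : ℝ :=
  area (tri i j k) * sSup ((fun x => ‖b x‖) '' tri i j k) / (height i j k * (2 + 1))
    + area (tri i j k) * sSup (c '' tri i j k) / ((2 + 1) * (2 + 2))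

/-- The generalized Delaunay condition on the edge from `i` to `j` shared by the triangles
`K` with vertices `i, j, k` and `K'` with vertices `i, j, k'`. -/
def EdgeCondition (D : Plane → Matrix (Fin 2) (Fin 2) ℝ) (b : Plane → Plane) (c : Plane → ℝ)
    (i j k k' : Plane) : Prop :=
  let δ := (avg D (tri i j k)).det
  let δ' := (avg D (tri i j k')).det
  let α := oppAngle D i j k
  let α' := oppAngle D i j k'
  let C := perturbation b c i j k + perturbation b c i j k'
  let θ := (1 / 2) * (α + α'
      + arccot (√(δ' / δ) * Real.cot α' - 2 * C / √δ)
      + arccot (√(δ / δ') * Real.cot α - 2 * C / √δ'))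
  0 < θ ∧ θ ≤ Real.pi

end P1FEM

/-! Write a(u, v) for the bilinear form of the scheme and φ_i for the nodal functions. Two
properties of a carry the theorem: a(φ_j, φ_i) ≤ 0 for every interior vertex i and every j ≠ i, and
a(w, w) ≤ 0 only for w = 0 when w is a nonnegative finite element function that vanishes off Ω.

Sign. An edge at an interior vertex belongs to exactly two elements (`sum_edge`). On each of them
the diffusion term equals -½ √(det D_K) cot α (`area_mul_form`), while convection and reaction add
at most `perturbation` (`elemForm_hat_le`). So the entry is nonpositive once 2C ≤ √δ cot α + √δ' cot
α', with δ, δ' the two determinants. The edge condition implies this (`EdgeCondition.le_cot`):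
otherwise its two arccot terms would exceed π - α and π - α', and the bracket would exceed 2π.

Coercivity. The diffusion part is positive definite. Integration by parts turns ∫ w b·∇w + c w² into
∫ (c - ½ div b) w² ≥ 0. Since div b is controlled only inside Ω, this is done for the truncation (w
- ε)⁺, whose square is Lipschitz with compact support in Ω; then ε → 0 (`IsP1.convection_nonneg`).

Maximum principle (`IsP1.le_of_subsolution`). Let M ≥ 0 bound the boundary values and split u = M +
W - N, where W and N interpolate the positive and negative parts of u - M at the vertices. If f ≤ 0
then a(u, W) ≤ 0. Moreover a(1, W) = ∫ c W ≥ 0, and a(N, W) ≤ 0 because only off-diagonal entries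
survive. Hence a(W, W) ≤ 0, so W = 0 and u = M - N ≤ M.

Applied to u and -u this gives both halves of the principle and uniqueness; existence follows
because the system for the interior nodal values is square. For the Laplacian each arccot undoes its
cotangent, so the bracket is twice the angle sum. -/

namespace P1FEM

open MeasureTheory Set Filter Topology

/-! ### Barycentric coordinates of a triangle -/

/-- A finite set consisting of the three vertices of a nondegenerate triangle. -/
def IsTriangle (K : Finset Plane) : Prop :=
  K.card = 3 ∧ AffineIndependent ℝ (fun a : K => (a : Plane))

theorem Triangulation.isTriangle {Ω : Set Plane} (T : Triangulation Ω) {K : Finset Plane}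
    (hK : K ∈ T.elems) : IsTriangle K :=
  ⟨T.card_eq K hK, T.indep K hK⟩

namespace IsTriangle

variable {K : Finset Plane}

/-- The vertices of a nondegenerate triangle as an affine basis of the plane. -/
noncomputable def basis (hK : IsTriangle K) : AffineBasis K ℝ Plane where
  toFun := fun a => (a : Plane)
  ind' := hK.2
  tot' := by
    rw [hK.2.affineSpan_eq_top_iff_card_eq_finrank_add_one]
    simp [hK.1]

theorem basis_apply (hK : IsTriangle K) (a : K) : hK.basis a = a := rfl

theorem range_basis (hK : IsTriangle K) : range hK.basis = (K : Set Plane) := by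
  ext x; simp [basis_apply]

end IsTriangle

open Classical in
/-- The barycentric coordinate of the triangle `K` that belongs to the vertex `a`. -/
noncomputable def bary (K : Finset Plane) (a : Plane) : Plane →ᵃ[ℝ] ℝ :=
  if h : IsTriangle K ∧ a ∈ K then h.1.basis.coord ⟨a, h.2⟩ else 0

namespace IsTriangle

variable {K : Finset Plane}

theorem bary_of_mem (hK : IsTriangle K) {a : Plane} (ha : a ∈ K) :
    bary K a = hK.basis.coord ⟨a, ha⟩ := by
  rw [bary, dif_pos ⟨hK, ha⟩]

/-- The default value zero makes `bary K a` the restriction to K of the nodal function of any vertex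
a, so sums may run over all vertices of the mesh. -/
theorem bary_of_notMem {a : Plane} (ha : a ∉ K) : bary K a = 0 := by
  rw [bary, dif_neg (fun h => ha h.2)]

theorem bary_self (hK : IsTriangle K) {a : Plane} (ha : a ∈ K) : bary K a a = 1 := by
  rw [hK.bary_of_mem ha]
  exact hK.basis.coord_apply_eq ⟨a, ha⟩

theorem bary_of_ne (hK : IsTriangle K) {a b : Plane} (hb : b ∈ K) (hab : a ≠ b) :
    bary K a b = 0 := by
  by_cases ha : a ∈ K
  · rw [hK.bary_of_mem ha]
    exact hK.basis.coord_apply_ne (i := ⟨a, ha⟩) (j := ⟨b, hb⟩) (by simpa using hab)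
  · rw [bary_of_notMem ha]; rfl

theorem affineSpan_eq_top (hK : IsTriangle K) : affineSpan ℝ (K : Set Plane) = ⊤ := by
  rw [← hK.range_basis]; exact hK.basis.tot

theorem affineMap_ext (hK : IsTriangle K) {l l' : Plane →ᵃ[ℝ] ℝ} (h : ∀ a ∈ K, l a = l' a) :
    l = l' :=
  AffineMap.ext_on hK.affineSpan_eq_top h

theorem sum_bary (hK : IsTriangle K) (x : Plane) : ∑ a ∈ K, bary K a x = 1 := by
  rw [← hK.basis.sum_coord_apply_eq_one x, ← Finset.sum_attach]
  exact Finset.sum_congr rfl fun a _ => by rw [hK.bary_of_mem a.2]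

theorem sum_bary_smul (hK : IsTriangle K) (x : Plane) : ∑ a ∈ K, bary K a x • a = x := by
  conv_rhs => rw [← hK.basis.linear_combination_coord_eq_self x]
  rw [← Finset.sum_attach]
  exact Finset.sum_congr rfl fun a _ => by rw [hK.bary_of_mem a.2]; rfl

theorem affineMap_apply_eq_sum (hK : IsTriangle K) (l : Plane →ᵃ[ℝ] ℝ) (x : Plane) :
    l x = ∑ a ∈ K, l a * bary K a x := by
  have happ : ∀ (s : Finset Plane) (y : Plane),
      (∑ a ∈ s, l a • bary K a) y = ∑ a ∈ s, l a * bary K a y := by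
    classical
    intro s y
    induction s using Finset.induction_on with
    | empty => simp
    | insert a s ha ih => simp [Finset.sum_insert ha, ih]
  have h : l = ∑ a ∈ K, l a • bary K a := by
    refine hK.affineMap_ext fun b hb => ?_
    rw [happ, Finset.sum_eq_single_of_mem b hb, hK.bary_self hb, mul_one]
    intro a _ hab
    rw [hK.bary_of_ne hb hab, mul_zero]
  rw [← happ, ← h]

theorem continuous_bary (K : Finset Plane) (a : Plane) : Continuous (bary K a) :=
  AffineMap.continuous_of_finiteDimensional _

theorem mem_convexHull_iff (hK : IsTriangle K) {x : Plane} :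
    x ∈ convexHull ℝ (K : Set Plane) ↔ ∀ a ∈ K, 0 ≤ bary K a x := by
  rw [← hK.range_basis, hK.basis.convexHull_eq_nonneg_coord]
  constructor
  · intro h a ha
    rw [hK.bary_of_mem ha]; exact h _
  · intro h a
    have := h a a.2
    rwa [hK.bary_of_mem a.2] at this

theorem bary_nonneg (hK : IsTriangle K) {x : Plane} (hx : x ∈ convexHull ℝ (K : Set Plane))
    (a : Plane) : 0 ≤ bary K a x := by
  by_cases ha : a ∈ K
  · exact hK.mem_convexHull_iff.1 hx a ha
  · rw [bary_of_notMem ha]; exact le_rfl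

theorem mem_interior_iff (hK : IsTriangle K) {x : Plane} :
    x ∈ interior (convexHull ℝ (K : Set Plane)) ↔ ∀ a ∈ K, 0 < bary K a x := by
  rw [← hK.range_basis, hK.basis.interior_convexHull]
  constructor
  · intro h a ha
    rw [hK.bary_of_mem ha]; exact h _
  · intro h a
    have := h a a.2
    rwa [hK.bary_of_mem a.2] at this

theorem centroid_mem_interior (hK : IsTriangle K) :
    K.centroid ℝ id ∈ interior (convexHull ℝ (K : Set Plane)) := by
  have h := hK.basis.centroid_mem_interior_convexHull
  rw [hK.range_basis] at h
  have h' := Finset.centroid_map ℝ (Finset.univ : Finset K) (Function.Embedding.subtype _)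
    (id : Plane → Plane)
  have hmap : Finset.map (Function.Embedding.subtype (· ∈ K)) Finset.univ = K :=
    Finset.attach_map_val
  rw [hmap] at h'
  rw [h']
  exact h

theorem isCompact_convexHull (K : Finset Plane) : IsCompact (convexHull ℝ (K : Set Plane)) :=
  K.finite_toSet.isCompact_convexHull (𝕜 := ℝ)

end IsTriangle

/-! ### The mesh, stars of interior vertices and nodal functions -/

namespace Triangulation

variable {Ω : Set Plane} (T : Triangulation Ω)

/-- The finite set of the vertices of the mesh. -/
noncomputable def vertexFinset : Finset Plane := by
  classical exact T.elems.biUnion id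

theorem mem_vertexFinset {a : Plane} : a ∈ T.vertexFinset ↔ a ∈ T.vertices := by
  classical
  simp [vertexFinset, vertices]

theorem subset_closure {K : Finset Plane} (hK : K ∈ T.elems) :
    convexHull ℝ (K : Set Plane) ⊆ closure Ω := by
  rw [← T.cover]
  exact subset_biUnion_of_mem (u := fun K : Finset Plane => convexHull ℝ (K : Set Plane)) hK

theorem exists_elem {x : Plane} (hx : x ∈ closure Ω) :
    ∃ K ∈ T.elems, x ∈ convexHull ℝ (K : Set Plane) := by
  rw [← T.cover] at hx
  simpa using hx

theorem isCompact_closure {Ω : Set Plane} (T : Triangulation Ω) : IsCompact (closure Ω) := by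
  rw [← T.cover]
  exact T.elems.finite_toSet.isCompact_biUnion fun K _ => IsTriangle.isCompact_convexHull K

theorem vertex_mem_closure {a : Plane} (ha : a ∈ T.vertices) : a ∈ closure Ω := by
  obtain ⟨K, hK, haK⟩ := ha
  exact T.subset_closure hK (subset_convexHull ℝ _ haK)

/-- By conformity x lies in the hull of the common vertices. There both affine functions take the
same value, 0 or 1, and the set where two affine functions agree is convex. -/
theorem bary_eq_bary {K K' : Finset Plane} (hK : K ∈ T.elems) (hK' : K' ∈ T.elems) {x : Plane}
    (hx : x ∈ convexHull ℝ (K : Set Plane)) (hx' : x ∈ convexHull ℝ (K' : Set Plane))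
    (a : Plane) : bary K a x = bary K' a x := by
  have h : x ∈ convexHull ℝ ((K : Set Plane) ∩ K') := by
    rw [← T.conforming K hK K' hK']; exact ⟨hx, hx'⟩
  have hc : Convex ℝ {y | bary K a y = bary K' a y} := by
    intro y hy z hz s t hs ht hst
    simp only [mem_ofPred_eq] at *
    rw [Convex.combo_affine_apply hst, Convex.combo_affine_apply hst, hy, hz]
  refine convexHull_min ?_ hc h
  rintro b ⟨hb, hb'⟩
  by_cases hab : a = b
  · subst hab
    simp only [mem_ofPred_eq]
    rw [(T.isTriangle hK).bary_self hb, (T.isTriangle hK').bary_self hb']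
  · simp only [mem_ofPred_eq]
    rw [(T.isTriangle hK).bary_of_ne hb hab, (T.isTriangle hK').bary_of_ne hb' hab]

theorem mem_of_bary_ne_zero {K K' : Finset Plane} (hK : K ∈ T.elems) (hK' : K' ∈ T.elems)
    {x : Plane} (hx : x ∈ convexHull ℝ (K : Set Plane)) (hx' : x ∈ convexHull ℝ (K' : Set Plane))
    {a : Plane} (ha : bary K a x ≠ 0) : a ∈ K' := by
  by_contra h
  rw [T.bary_eq_bary hK hK' hx hx' a, IsTriangle.bary_of_notMem h] at ha
  exact ha rfl

theorem bary_lineMap (K : Finset Plane) (a x y : Plane) (t : ℝ) :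
    bary K a (AffineMap.lineMap x y t) = (1 - t) * bary K a x + t * bary K a y := by
  rw [AffineMap.apply_lineMap, AffineMap.lineMap_apply_ring']
  ring

theorem tendsto_lineMap_zero (x y : Plane) :
    Tendsto (fun t : ℝ => (AffineMap.lineMap x y t : Plane)) (𝓝 0) (𝓝 x) := by
  have h1 : Continuous (fun t : ℝ => (AffineMap.lineMap x y t : Plane)) :=
    AffineMap.lineMap_continuous
  have h2 := h1.tendsto 0
  rwa [AffineMap.lineMap_apply_zero] at h2

/-- The open star of an interior vertex is contained in the domain. -/
theorem mem_of_bary_pos (hreg : interior (closure Ω) = Ω) {K : Finset Plane} (hK : K ∈ T.elems)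
    {a x : Plane} (haK : a ∈ K) (ha : a ∈ Ω) (hx : x ∈ convexHull ℝ (K : Set Plane))
    (hpos : 0 < bary K a x) : x ∈ Ω := by
  have hΩ : IsOpen Ω := hreg ▸ isOpen_interior
  -- Contract towards a until the image of x falls into the open set Ω. The elements around that
  -- image will be blown up again from a to cover a neighbourhood of x.
  obtain ⟨t, htΩ, ht0, ht1⟩ : ∃ t : ℝ, (AffineMap.lineMap a x t : Plane) ∈ Ω ∧ 0 < t ∧ t < 1 := by
    have h1 := ((tendsto_lineMap_zero a x).mono_left
      (nhdsWithin_le_nhds (s := Ioi 0))).eventually (hΩ.mem_nhds ha)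
    have h2 : ∀ᶠ t : ℝ in 𝓝[>] 0, t ∈ Ioo (0 : ℝ) 1 := Ioo_mem_nhdsGT one_pos
    obtain ⟨t, h⟩ := (h1.and h2).exists
    exact ⟨t, h.1, h.2.1, h.2.2⟩
  have hcont : Continuous (fun y : Plane => (AffineMap.lineMap a y t : Plane)) := by
    simp only [AffineMap.lineMap_apply]
    fun_prop
  have hxt : (AffineMap.lineMap a x t : Plane) ∈ convexHull ℝ (K : Set Plane) :=
    (convex_convexHull ℝ _).lineMap_mem (subset_convexHull ℝ _ haK) hx ⟨ht0.le, ht1.le⟩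
  have hxta : bary K a (AffineMap.lineMap a x t) ≠ 0 := by
    rw [bary_lineMap, (T.isTriangle hK).bary_self haK]
    have := mul_pos ht0 hpos
    linarith
  -- An element L that contains the contracted x has a as a vertex. Undoing the contraction divides
  -- the other coordinates by t > 0, which keeps their signs, and the coordinate of a stays positive
  -- near x by continuity. So points near x return to L.
  have hev : ∀ L ∈ T.elems, ∀ᶠ y in 𝓝 x,
      (AffineMap.lineMap a y t : Plane) ∈ convexHull ℝ (L : Set Plane) →
        y ∈ convexHull ℝ (L : Set Plane) := by
    intro L hL
    by_cases hxL : (AffineMap.lineMap a x t : Plane) ∈ convexHull ℝ (L : Set Plane)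
    · have haL : a ∈ L := T.mem_of_bary_ne_zero hK hL hxt hxL hxta
      have heq := T.bary_eq_bary hK hL hxt hxL a
      rw [bary_lineMap, bary_lineMap, (T.isTriangle hK).bary_self haK, (T.isTriangle hL).bary_self haL] at heq
      have hxa : 0 < bary L a x := by
        have : bary K a x = bary L a x := by
          have : t * bary K a x = t * bary L a x := by linarith
          exact mul_left_cancel₀ ht0.ne' this
        rwa [← this]
      filter_upwards [(IsTriangle.continuous_bary L a).continuousAt.eventually (lt_mem_nhds hxa)]
        with y hy hyt
      rw [(T.isTriangle hL).mem_convexHull_iff] at hyt ⊢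
      intro e he
      by_cases hea : e = a
      · rw [hea]; exact le_of_lt hy
      · have := hyt e he
        rw [bary_lineMap, (T.isTriangle hL).bary_of_ne haL hea, mul_zero, zero_add] at this
        exact nonneg_of_mul_nonneg_right this ht0
    · have hop : IsOpen (convexHull ℝ (L : Set Plane))ᶜ :=
        (IsTriangle.isCompact_convexHull L).isClosed.isOpen_compl
      filter_upwards [hcont.continuousAt.eventually (hop.mem_nhds hxL)] with y hy hyt
      exact absurd hyt hy
  have hall := (Finset.eventually_all T.elems).2 hev
  rw [← hreg, mem_interior_iff_mem_nhds]
  filter_upwards [hall, hcont.continuousAt.eventually (hΩ.mem_nhds htΩ)] with y hy hyΩ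
  obtain ⟨L, hL, hyL⟩ := T.exists_elem (_root_.subset_closure hyΩ)
  exact T.subset_closure hL (hy L hL hyL)

open Classical in
/-- The nodal basis function of the vertex `a`, extended by zero outside the closure of `Ω`. -/
noncomputable def hat (a x : Plane) : ℝ :=
  if h : ∃ K ∈ T.elems, x ∈ convexHull ℝ (K : Set Plane) then bary h.choose a x else 0

theorem hat_eq_bary {K : Finset Plane} (hK : K ∈ T.elems) {x : Plane}
    (hx : x ∈ convexHull ℝ (K : Set Plane)) (a : Plane) : T.hat a x = bary K a x := by
  have h : ∃ K ∈ T.elems, x ∈ convexHull ℝ (K : Set Plane) := ⟨K, hK, hx⟩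
  rw [hat, dif_pos h]
  exact T.bary_eq_bary h.choose_spec.1 hK h.choose_spec.2 hx a

theorem hat_of_notMem_closure {x : Plane} (hx : x ∉ closure Ω) (a : Plane) : T.hat a x = 0 := by
  rw [hat, dif_neg]
  rintro ⟨K, hK, hxK⟩
  exact hx (T.subset_closure hK hxK)

theorem hat_nonneg (a x : Plane) : 0 ≤ T.hat a x := by
  by_cases hx : x ∈ closure Ω
  · obtain ⟨K, hK, hxK⟩ := T.exists_elem hx
    rw [T.hat_eq_bary hK hxK]
    exact (T.isTriangle hK).bary_nonneg hxK a
  · rw [T.hat_of_notMem_closure hx]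

theorem hat_self {a : Plane} (ha : a ∈ T.vertices) : T.hat a a = 1 := by
  obtain ⟨K, hK, haK⟩ := ha
  rw [T.hat_eq_bary hK (subset_convexHull ℝ _ haK), (T.isTriangle hK).bary_self haK]

theorem hat_of_ne {a b : Plane} (hb : b ∈ T.vertices) (hab : a ≠ b) : T.hat a b = 0 := by
  obtain ⟨K, hK, hbK⟩ := hb
  rw [T.hat_eq_bary hK (subset_convexHull ℝ _ hbK), (T.isTriangle hK).bary_of_ne hbK hab]

/-- The support of the nodal function of an interior vertex can meet ∂Ω, but by `mem_of_bary_pos`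
the function is positive only inside Ω. Extension by zero is therefore harmless. -/
theorem hat_of_notMem (hreg : interior (closure Ω) = Ω) {a x : Plane} (ha : a ∈ Ω) (hx : x ∉ Ω) :
    T.hat a x = 0 := by
  by_cases hxc : x ∈ closure Ω
  · obtain ⟨K, hK, hxK⟩ := T.exists_elem hxc
    rw [T.hat_eq_bary hK hxK]
    by_cases haK : a ∈ K
    · by_contra h
      exact hx (T.mem_of_bary_pos hreg hK haK ha hxK
        (lt_of_le_of_ne ((T.isTriangle hK).bary_nonneg hxK a) (Ne.symm h)))
    · rw [IsTriangle.bary_of_notMem haK]; rfl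
  · exact T.hat_of_notMem_closure hxc a

theorem continuousOn_of_forall_elem {X : Type*} [TopologicalSpace X] {u : Plane → X}
    (h : ∀ K ∈ T.elems, ContinuousOn u (convexHull ℝ (K : Set Plane))) :
    ContinuousOn u (closure Ω) := by
  have hU : closure Ω = ⋃ K : T.elems, convexHull ℝ ((K : Finset Plane) : Set Plane) := by
    rw [← T.cover, iUnion_subtype]
  rw [hU]
  exact (locallyFinite_of_finite _).continuousOn_iUnion
    (fun K => (IsTriangle.isCompact_convexHull K.1).isClosed) fun K => h K.1 K.2

/-- The elements are finitely many closed sets, so continuity on the closure follows by pasting. -/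
theorem isP1_of_forall_elem {u : Plane → ℝ}
    (h : ∀ K ∈ T.elems, ∃ l : Plane →ᵃ[ℝ] ℝ, EqOn u l (convexHull ℝ (K : Set Plane))) :
    T.IsP1 u := by
  refine ⟨T.continuousOn_of_forall_elem fun K hK => ?_, h⟩
  obtain ⟨l, hl⟩ := h K hK
  exact (AffineMap.continuous_of_finiteDimensional l).continuousOn.congr hl

theorem isP1_hat (a : Plane) : T.IsP1 (T.hat a) :=
  T.isP1_of_forall_elem fun K hK => ⟨bary K a, fun _ hx => T.hat_eq_bary hK hx a⟩

theorem sum_vertexFinset_mul_bary {K : Finset Plane} (hK : K ∈ T.elems) (z : Plane → ℝ)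
    (x : Plane) : ∑ a ∈ T.vertexFinset, z a * bary K a x = ∑ a ∈ K, z a * bary K a x := by
  symm
  refine Finset.sum_subset (fun a ha => T.mem_vertexFinset.2 ⟨K, hK, ha⟩) fun a _ ha => ?_
  rw [IsTriangle.bary_of_notMem ha]
  exact mul_zero _

/-- A linear finite element function is determined by its values at the vertices. -/
theorem IsP1.eq_sum {T : Triangulation Ω} {u : Plane → ℝ} (hu : T.IsP1 u) {x : Plane}
    (hx : x ∈ closure Ω) : u x = ∑ a ∈ T.vertexFinset, u a * T.hat a x := by
  obtain ⟨K, hK, hxK⟩ := T.exists_elem hx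
  obtain ⟨l, hl⟩ := hu.2 K hK
  simp_rw [T.hat_eq_bary hK hxK]
  rw [T.sum_vertexFinset_mul_bary hK, hl hxK, (T.isTriangle hK).affineMap_apply_eq_sum l x]
  exact Finset.sum_congr rfl fun a ha => by rw [hl (subset_convexHull ℝ _ ha)]

theorem isP1_one (T : Triangulation Ω) : T.IsP1 (fun _ => (1 : ℝ)) :=
  T.isP1_of_forall_elem fun _ _ => ⟨AffineMap.const ℝ Plane (1 : ℝ), fun _ _ => rfl⟩

theorem sum_hat {x : Plane} (hx : x ∈ closure Ω) : ∑ a ∈ T.vertexFinset, T.hat a x = 1 := by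
  simpa using (T.isP1_one.eq_sum hx).symm

end Triangulation

/-! ### Gradients, areas and integrals of barycentric coordinates -/

/-- The determinant of two vectors of the plane. -/
def cross (x y : Plane) : ℝ := x 0 * y 1 - x 1 * y 0

/-- The gradient of an affine function. -/
noncomputable def affGrad (l : Plane →ᵃ[ℝ] ℝ) : Plane :=
  (InnerProductSpace.toDual ℝ Plane).symm (LinearMap.toContinuousLinearMap l.linear)

theorem inner_affGrad (l : Plane →ᵃ[ℝ] ℝ) (v : Plane) : inner ℝ (affGrad l) v = l.linear v := by
  simp [affGrad]

theorem affGrad_zero : affGrad 0 = 0 := by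
  simp [affGrad]

theorem hasGradientAt_affine (l : Plane →ᵃ[ℝ] ℝ) (x : Plane) : HasGradientAt l (affGrad l) x := by
  rw [hasGradientAt_iff_hasFDerivAt, affGrad, LinearIsometryEquiv.apply_symm_apply]
  have h : (l : Plane → ℝ) = fun y => LinearMap.toContinuousLinearMap l.linear y + l 0 := by
    funext y
    have := l.map_vadd 0 y
    simpa using this
  rw [h]
  exact (ContinuousLinearMap.hasFDerivAt _).add_const _

namespace IsTriangle

variable {K : Finset Plane}

/-- The element gradient of a function that is affine on the element. -/
theorem elemGrad_eq (hK : IsTriangle K) {u : Plane → ℝ} {l : Plane →ᵃ[ℝ] ℝ}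
    (h : EqOn u l (convexHull ℝ (K : Set Plane))) : elemGrad K u = affGrad l := by
  have hev : u =ᶠ[𝓝 (K.centroid ℝ id)] l := by
    filter_upwards [mem_interior_iff_mem_nhds.1 hK.centroid_mem_interior] with x hx using h hx
  exact ((hasGradientAt_affine l _).congr_of_eventuallyEq hev).gradient

theorem ne_of_coe_eq (hK : IsTriangle K) {i j k : Plane} (h : (K : Set Plane) = {i, j, k}) :
    i ≠ j ∧ i ≠ k ∧ j ≠ k := by
  have h3 : ({i, j, k} : Set Plane).ncard = 3 := by rw [← h, ncard_coe_finset, hK.1]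
  have h2 : ∀ a b : Plane, ({a, b} : Set Plane).ncard ≠ 3 := fun a b hab => by
    have := ncard_insert_le a {b}
    rw [ncard_singleton] at this
    omega
  refine ⟨?_, ?_, ?_⟩ <;> rintro rfl
  · exact h2 i k (by simpa using h3)
  · exact h2 j i (by rwa [insert_comm, insert_eq_of_mem (mem_singleton i)] at h3)
  · exact h2 i j (by simpa using h3)

theorem sum_eq {M : Type*} [AddCommMonoid M] (hK : IsTriangle K) {i j k : Plane}
    (h : (K : Set Plane) = {i, j, k}) (f : Plane → M) : ∑ a ∈ K, f a = f i + (f j + f k) := by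
  classical
  obtain ⟨hij, hik, hjk⟩ := hK.ne_of_coe_eq h
  have hK' : K = {i, j, k} := by
    rw [← Finset.coe_inj, h]; simp
  rw [hK', Finset.sum_insert (by simp [hij, hik]), Finset.sum_pair hjk]

theorem sub_eq (hK : IsTriangle K) {i j k : Plane} (h : (K : Set Plane) = {i, j, k})
    (x : Plane) : x - k = bary K i x • (i - k) + bary K j x • (j - k) := by
  have h1 := hK.sum_bary x
  have h2 := hK.sum_bary_smul x
  rw [hK.sum_eq h] at h1 h2
  have h3 : bary K k x = 1 - bary K i x - bary K j x := by linarith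
  rw [h3] at h2
  conv_lhs => rw [← h2]
  module

/-- Cramer's rule: pairing x - k = λ_i (i - k) + λ_j (j - k) with j - k removes the second term. -/
theorem cross_eq (hK : IsTriangle K) {i j k : Plane} (h : (K : Set Plane) = {i, j, k})
    (x : Plane) : cross (x - k) (j - k) = bary K i x * cross (i - k) (j - k) := by
  rw [hK.sub_eq h x]
  simp only [cross, PiLp.add_apply, PiLp.smul_apply, smul_eq_mul]
  ring

theorem cross_ne_zero (hK : IsTriangle K) {i j k : Plane} (h : (K : Set Plane) = {i, j, k}) :
    cross (i - k) (j - k) ≠ 0 := by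
  intro h0
  have hx : ∀ v : Plane, cross v (j - k) = 0 := fun v => by
    have := hK.cross_eq h (v + k)
    rwa [h0, mul_zero, add_sub_cancel_right] at this
  have h1 := hx (EuclideanSpace.single 0 1)
  have h2 := hx (EuclideanSpace.single 1 1)
  simp only [cross, PiLp.single_apply] at h1 h2
  refine (hK.ne_of_coe_eq h).2.2 (sub_eq_zero.1 ?_)
  ext r
  fin_cases r
  · have : k 0 - j 0 = 0 := by simpa using h2
    simp only [Fin.zero_eta, PiLp.sub_apply, PiLp.zero_apply]; linarith
  · simpa using h1

theorem bary_linear (hK : IsTriangle K) {i j k : Plane} (h : (K : Set Plane) = {i, j, k})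
    (v : Plane) : (bary K i).linear v = cross v (j - k) / cross (i - k) (j - k) := by
  rw [eq_div_iff (hK.cross_ne_zero h)]
  have h1 := hK.cross_eq h (v + k)
  have h2 := hK.cross_eq h k
  have h3 := (bary K i).map_vadd k v
  simp only [vadd_eq_add] at h3
  have h4 : bary K i k = 0 := hK.bary_of_ne (by rw [← Finset.mem_coe, h]; simp)
    (hK.ne_of_coe_eq h).2.1
  rw [h3, h4, add_zero, add_sub_cancel_right] at h1
  exact h1.symm

/-- The gradient is the opposite side turned by a right angle, divided by twice the signed area. -/
theorem affGrad_bary (hK : IsTriangle K) {i j k : Plane} (h : (K : Set Plane) = {i, j, k}) :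
    affGrad (bary K i) 0 = (j - k) 1 / cross (i - k) (j - k) ∧
      affGrad (bary K i) 1 = -(j - k) 0 / cross (i - k) (j - k) := by
  have hr : ∀ r : Fin 2, affGrad (bary K i) r = (bary K i).linear (EuclideanSpace.single r 1) := by
    intro r
    rw [← inner_affGrad, EuclideanSpace.inner_single_right]
    simp
  rw [hr, hr, hK.bary_linear h, hK.bary_linear h]
  simp [cross]

theorem affGrad_bary_of_notMem {a : Plane} (ha : a ∉ K) : affGrad (bary K a) = 0 := by
  rw [bary_of_notMem ha, affGrad_zero]

theorem volume_frontier (K : Finset Plane) :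
    volume (frontier (convexHull ℝ (K : Set Plane))) = 0 :=
  (convex_convexHull ℝ _).addHaar_frontier volume

theorem ae_mem_interior (K : Finset Plane) :
    ∀ᵐ x ∂(volume.restrict (convexHull ℝ (K : Set Plane))),
      x ∈ interior (convexHull ℝ (K : Set Plane)) := by
  have hc := (isCompact_convexHull K).isClosed
  rw [ae_restrict_iff' hc.measurableSet]
  have := measure_eq_zero_iff_ae_notMem.1 (volume_frontier K)
  filter_upwards [this] with x hx hxK
  by_contra h
  exact hx ⟨subset_closure hxK, h⟩

end IsTriangle

/-- The reference triangle. -/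
def refTriangle : Set Plane := {y | 0 ≤ y 0 ∧ 0 ≤ y 1 ∧ y 0 + y 1 ≤ 1}

/-- Fubini for the indicator of the triangle: the slice at s is [0, 1 - s] for s in [0, 1] and empty
otherwise. -/
theorem integral_refTriangle {F : ℝ → ℝ → ℝ} (hF : Continuous fun p : ℝ × ℝ => F p.1 p.2) :
    ∫ y in refTriangle, F (y 0) (y 1) = ∫ s in (0 : ℝ)..1, ∫ t in (0 : ℝ)..(1 - s), F s t := by
  let S : Set (ℝ × ℝ) := {p | 0 ≤ p.1 ∧ 0 ≤ p.2 ∧ p.1 + p.2 ≤ 1}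
  have hS : IsCompact S := by
    refine (isCompact_Icc (a := ((0 : ℝ), (0 : ℝ))) (b := (1, 1))).of_isClosed_subset ?_ ?_
    · have h1 : IsClosed {p : ℝ × ℝ | 0 ≤ p.1} := isClosed_le (by fun_prop) (by fun_prop)
      have h2 : IsClosed {p : ℝ × ℝ | 0 ≤ p.2} := isClosed_le (by fun_prop) (by fun_prop)
      have h3 : IsClosed {p : ℝ × ℝ | p.1 + p.2 ≤ 1} := isClosed_le (by fun_prop) (by fun_prop)
      exact h1.inter (h2.inter h3)
    · rintro ⟨s, t⟩ ⟨h1, h2, h3⟩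
      simp only at h1 h2 h3
      exact ⟨⟨h1, h2⟩, ⟨by simp only; linarith, by simp only; linarith⟩⟩
  have hmp : MeasurePreserving (fun y : Plane => (y 0, y 1)) volume volume :=
    (volume_preserving_finTwoArrow ℝ).comp (PiLp.volume_preserving_ofLp (Fin 2))
  have hemb : MeasurableEmbedding (fun y : Plane => (y 0, y 1)) :=
    (MeasurableEquiv.finTwoArrow (α := ℝ)).measurableEmbedding.comp
      (MeasurableEquiv.toLp 2 (Fin 2 → ℝ)).symm.measurableEmbedding
  have h1 : ∫ y in refTriangle, F (y 0) (y 1) = ∫ p in S, F p.1 p.2 :=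
    hmp.setIntegral_preimage_emb hemb (fun p : ℝ × ℝ => F p.1 p.2) S
  have hint : IntegrableOn (fun p : ℝ × ℝ => F p.1 p.2) S := hF.continuousOn.integrableOn_compact hS
  rw [h1, ← integral_indicator hS.isClosed.measurableSet, Measure.volume_eq_prod,
    integral_prod _ ((integrable_indicator_iff hS.isClosed.measurableSet).2 hint),
    intervalIntegral.integral_of_le zero_le_one, ← integral_Icc_eq_integral_Ioc,
    ← integral_indicator measurableSet_Icc]
  congr 1
  funext s
  by_cases hs : s ∈ Icc (0 : ℝ) 1
  · rw [indicator_of_mem hs, intervalIntegral.integral_of_le (by linarith [hs.2]),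
      ← integral_Icc_eq_integral_Ioc, ← integral_indicator measurableSet_Icc]
    congr 1
    funext t
    by_cases ht : t ∈ Icc (0 : ℝ) (1 - s)
    · rw [indicator_of_mem ht, indicator_of_mem]
      exact ⟨hs.1, ht.1, by have := ht.2; simp only; linarith⟩
    · rw [indicator_of_notMem ht, indicator_of_notMem]
      rintro ⟨-, h2, h3⟩
      exact ht ⟨h2, by simp only at h3; linarith⟩
  · rw [indicator_of_notMem hs]
    rw [integral_eq_zero_of_ae]
    refine Eventually.of_forall fun t => ?_
    refine indicator_of_notMem ?_ _
    rintro ⟨h1, h2, h3⟩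
    simp only at h1 h2 h3
    exact hs ⟨h1, by linarith⟩

namespace IsTriangle

variable {K : Finset Plane}

/-- Change of variables by y ↦ y₀ (i - k) + y₁ (j - k) + k, which maps the reference triangle onto
K, has Jacobian `cross (i - k) (j - k)` and turns the coordinates of i and j into y₀ and y₁. -/
theorem integral_bary (hK : IsTriangle K) {i j k : Plane} (h : (K : Set Plane) = {i, j, k})
    {F : ℝ → ℝ → ℝ} (hF : Continuous fun p : ℝ × ℝ => F p.1 p.2) :
    ∫ x in convexHull ℝ (K : Set Plane), F (bary K i x) (bary K j x)
      = |cross (i - k) (j - k)| * ∫ s in (0 : ℝ)..1, ∫ t in (0 : ℝ)..(1 - s), F s t := by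
  obtain ⟨hij, hik, hjk⟩ := hK.ne_of_coe_eq h
  have hiK : i ∈ K := by rw [← Finset.mem_coe, h]; simp
  have hjK : j ∈ K := by rw [← Finset.mem_coe, h]; simp
  have hkK : k ∈ K := by rw [← Finset.mem_coe, h]; simp
  let L : Plane →L[ℝ] Plane :=
    (EuclideanSpace.proj (0 : Fin 2) : Plane →L[ℝ] ℝ).smulRight (i - k)
      + (EuclideanSpace.proj (1 : Fin 2) : Plane →L[ℝ] ℝ).smulRight (j - k)
  have hL : ∀ y, L y = y 0 • (i - k) + y 1 • (j - k) := fun y => by simp [L]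
  have hdet : L.det = cross (i - k) (j - k) := by
    rw [ContinuousLinearMap.det,
      ← LinearMap.det_toMatrix (EuclideanSpace.basisFun (Fin 2) ℝ).toBasis, Matrix.det_fin_two]
    simp [LinearMap.toMatrix_apply, hL, cross]
    ring
  have hbi : ∀ y, bary K i (L y + k) = y 0 := fun y => by
    have h1 := hK.cross_eq h (L y + k)
    rw [add_sub_cancel_right, hL] at h1
    refine mul_right_cancel₀ (hK.cross_ne_zero h) (h1.symm.trans ?_)
    simp only [cross, PiLp.add_apply, PiLp.smul_apply, smul_eq_mul]
    ring
  have h' : (K : Set Plane) = {j, i, k} := by rw [h, insert_comm]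
  have hbj : ∀ y, bary K j (L y + k) = y 1 := fun y => by
    have h1 := hK.cross_eq h' (L y + k)
    rw [add_sub_cancel_right, hL] at h1
    refine mul_right_cancel₀ (hK.cross_ne_zero h') (h1.symm.trans ?_)
    simp only [cross, PiLp.add_apply, PiLp.smul_apply, smul_eq_mul]
    ring
  have hbk : ∀ x, bary K k x = 1 - bary K i x - bary K j x := fun x => by
    have := hK.sum_bary x
    rw [hK.sum_eq h] at this
    linarith
  have himg : (fun y => L y + k) '' refTriangle = convexHull ℝ (K : Set Plane) := by
    ext x
    rw [hK.mem_convexHull_iff]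
    constructor
    · rintro ⟨y, ⟨h0, h1, h2⟩, rfl⟩ a ha
      rw [← Finset.mem_coe, h] at ha
      rcases ha with rfl | rfl | rfl
      · simp only [hbi]; exact h0
      · simp only [hbj]; exact h1
      · simp only [hbk, hbi, hbj]; linarith
    · intro hx
      refine ⟨!₂[bary K i x, bary K j x], ⟨?_, ?_, ?_⟩, ?_⟩
      · simpa using hx i hiK
      · simpa using hx j hjK
      · have := hx k hkK
        rw [hbk] at this
        simp; linarith
      · have := hK.sub_eq h x
        simp only [hL]
        simp only [Matrix.cons_val_zero, Matrix.cons_val_one]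
        rw [← this]; abel
  have hmeas : MeasurableSet refTriangle := by
    have : IsClosed refTriangle := by
      have h1 : IsClosed {y : Plane | 0 ≤ y 0} := isClosed_le (by fun_prop) (by fun_prop)
      have h2 : IsClosed {y : Plane | 0 ≤ y 1} := isClosed_le (by fun_prop) (by fun_prop)
      have h3 : IsClosed {y : Plane | y 0 + y 1 ≤ 1} := isClosed_le (by fun_prop) (by fun_prop)
      exact h1.inter (h2.inter h3)
    exact this.measurableSet
  have hinj : InjOn (fun y => L y + k) refTriangle := by
    intro y _ z _ hyz
    simp only at hyz
    ext r
    fin_cases r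
    · have := hbi y; rw [hyz, hbi] at this; exact this.symm
    · have := hbj y; rw [hyz, hbj] at this; exact this.symm
  rw [← himg, integral_image_eq_integral_abs_det_fderiv_smul volume hmeas
    (fun y _ => (L.hasFDerivAt.add_const k).hasFDerivWithinAt) hinj, ← integral_refTriangle hF,
    ← integral_const_mul, hdet]
  simp only [hbi, hbj, smul_eq_mul]

theorem area_eq (hK : IsTriangle K) {i j k : Plane} (h : (K : Set Plane) = {i, j, k}) :
    area (convexHull ℝ (K : Set Plane)) = |cross (i - k) (j - k)| / 2 := by
  have := hK.integral_bary h (F := fun _ _ => 1) (by fun_prop)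
  simp only [integral_const, measureReal_restrict_apply_univ, smul_eq_mul, mul_one,
    intervalIntegral.integral_const] at this
  have h2 : ∫ s in (0 : ℝ)..1, (1 - s - 0) = 1 / 2 := by
    simp only [sub_zero]
    rw [intervalIntegral.integral_sub (by simp) (by simp)]
    simp
    norm_num
  rw [area, this, h2]
  ring

theorem area_pos (hK : IsTriangle K) : 0 < area (convexHull ℝ (K : Set Plane)) := by
  classical
  obtain ⟨i, j, k, -, -, -, h⟩ := Finset.card_eq_three.1 hK.1
  have h' : (K : Set Plane) = {i, j, k} := by rw [h]; simp
  rw [hK.area_eq h']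
  have := abs_pos.2 (hK.cross_ne_zero h')
  positivity

theorem integral_bary_left (hK : IsTriangle K) {i j k : Plane} (h : (K : Set Plane) = {i, j, k}) :
    ∫ x in convexHull ℝ (K : Set Plane), bary K i x = area (convexHull ℝ (K : Set Plane)) / 3 := by
  have := hK.integral_bary h (F := fun s _ => s) (by fun_prop)
  simp only [intervalIntegral.integral_const, smul_eq_mul] at this
  rw [hK.area_eq h, this]
  have h2 : ∫ s in (0 : ℝ)..1, (1 - s - 0) * s = 1 / 6 := by
    have : ∀ s : ℝ, (1 - s - 0) * s = s - s ^ 2 := fun s => by ring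
    simp_rw [this]
    rw [intervalIntegral.integral_sub (by simp) (by simp)]
    simp
    norm_num
  rw [h2]; ring

theorem integral_bary_mul_bary (hK : IsTriangle K) {i j k : Plane}
    (h : (K : Set Plane) = {i, j, k}) :
    ∫ x in convexHull ℝ (K : Set Plane), bary K i x * bary K j x
      = area (convexHull ℝ (K : Set Plane)) / 12 := by
  have := hK.integral_bary h (F := fun s t => s * t) (by fun_prop)
  rw [hK.area_eq h, this]
  have h2 : ∫ s in (0 : ℝ)..1, ∫ t in (0 : ℝ)..(1 - s), s * t = 1 / 24 := by
    have : ∀ s : ℝ, ∫ t in (0 : ℝ)..(1 - s), s * t = s / 2 - s ^ 2 + s ^ 3 / 2 := fun s => by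
      rw [intervalIntegral.integral_const_mul, integral_id]; ring
    simp_rw [this]
    rw [intervalIntegral.integral_add ((by fun_prop : Continuous _).intervalIntegrable _ _)
      ((by fun_prop : Continuous _).intervalIntegrable _ _),
      intervalIntegral.integral_sub ((by fun_prop : Continuous _).intervalIntegrable _ _)
      ((by fun_prop : Continuous _).intervalIntegrable _ _)]
    simp
    norm_num
  rw [h2]; ring

end IsTriangle

/-! ### Integrals over the domain as sums over elements -/

namespace Triangulation

variable {Ω : Set Plane} (T : Triangulation Ω)

/-- At a common point interior to K all coordinates are positive, so every vertex of K is one of K'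
and the elements coincide. Distinct elements thus meet inside the null set ∂K. -/
theorem aedisjoint {K K' : Finset Plane} (hK : K ∈ T.elems) (hK' : K' ∈ T.elems) (hne : K ≠ K') :
    AEDisjoint volume (convexHull ℝ (K : Set Plane)) (convexHull ℝ (K' : Set Plane)) := by
  refine measure_mono_null ?_ (IsTriangle.volume_frontier K)
  rintro x ⟨hx, hx'⟩
  refine ⟨_root_.subset_closure hx, fun hi => hne ?_⟩
  rw [(T.isTriangle hK).mem_interior_iff] at hi
  refine Finset.eq_of_subset_of_card_le
    (fun a ha => T.mem_of_bary_ne_zero hK hK' hx hx' (hi a ha).ne') ?_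
  rw [(T.isTriangle hK).1, (T.isTriangle hK').1]

theorem integral_closure {f : Plane → ℝ} (hf : IntegrableOn f (closure Ω)) :
    ∫ x in closure Ω, f x = ∑ K ∈ T.elems, ∫ x in convexHull ℝ (K : Set Plane), f x := by
  have hU : closure Ω = ⋃ K : T.elems, convexHull ℝ ((K : Finset Plane) : Set Plane) := by
    rw [← T.cover, iUnion_subtype]
  rw [hU] at hf ⊢
  have hs := hasSum_integral_iUnion_ae (μ := volume) (f := f)
    (s := fun K : T.elems => convexHull ℝ ((K : Finset Plane) : Set Plane))
    (fun K => (IsTriangle.isCompact_convexHull _).isClosed.measurableSet.nullMeasurableSet)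
    (fun K K' hne => T.aedisjoint K.2 K'.2 fun h => hne (Subtype.ext h)) hf
  rw [← hs.tsum_eq, tsum_fintype,
    Finset.sum_coe_sort T.elems fun K => ∫ x in convexHull ℝ (K : Set Plane), f x]

theorem interior_subset (hreg : interior (closure Ω) = Ω) {K : Finset Plane} (hK : K ∈ T.elems) :
    interior (convexHull ℝ (K : Set Plane)) ⊆ Ω := by
  rw [← hreg]
  exact interior_mono (T.subset_closure hK)

end Triangulation

/-! ### Angles in the metric of an inverse matrix; the edge condition in cotangents -/

theorem form_eq (M : Matrix (Fin 2) (Fin 2) ℝ) (x y : Plane) :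
    form M x y = x 0 * (M 0 0 * y 0 + M 0 1 * y 1) + x 1 * (M 1 0 * y 0 + M 1 1 * y 1) := by
  simp [form, dotProduct, Matrix.mulVec, Fin.sum_univ_two]

theorem form_pos_of_posDef {M : Matrix (Fin 2) (Fin 2) ℝ} (hM : M.PosDef) {x : Plane}
    (hx : x ≠ 0) : 0 < form M x x := by
  have := hM.dotProduct_mulVec_pos (x := x.ofLp) (by simpa using hx)
  simpa [form] using this

theorem posDef_of_form_pos {M : Matrix (Fin 2) (Fin 2) ℝ} (hsymm : M 0 1 = M 1 0)
    (hpos : ∀ x : Plane, x ≠ 0 → 0 < form M x x) : M.PosDef := by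
  refine Matrix.PosDef.of_dotProduct_mulVec_pos ?_ fun x hx => ?_
  · ext r s
    fin_cases r <;> fin_cases s <;> simp [hsymm]
  · have := hpos (WithLp.toLp 2 x) (by simpa using hx)
    simpa [form] using this

theorem symm_of_posDef {M : Matrix (Fin 2) (Fin 2) ℝ} (hM : M.PosDef) : M 0 1 = M 1 0 := by
  simpa using hM.isHermitian.apply 1 0

theorem form_inv (M : Matrix (Fin 2) (Fin 2) ℝ) (x y : Plane) :
    form M⁻¹ x y = (x 0 * (M 1 1 * y 0 - M 0 1 * y 1) + x 1 * (M 0 0 * y 1 - M 1 0 * y 0))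
      / M.det := by
  rw [form_eq, Matrix.inv_def, Matrix.adjugate_fin_two, Ring.inverse_eq_inv']
  simp
  ring

theorem ne_zero_of_cross_ne_zero {p q : Plane} (h : cross p q ≠ 0) : p ≠ 0 ∧ q ≠ 0 := by
  constructor <;> rintro rfl <;> simp [cross] at h

/-- The cotangent of an angle measured in the metric of an inverse matrix. -/
theorem metricAngle_inv {P : Matrix (Fin 2) (Fin 2) ℝ} (hP : P.PosDef) {p q : Plane}
    (h : cross p q ≠ 0) :
    0 < metricAngle P⁻¹ p q ∧ metricAngle P⁻¹ p q < Real.pi ∧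
      Real.cot (metricAngle P⁻¹ p q) = form P⁻¹ p q * √P.det / |cross p q| := by
  obtain ⟨hp, hq⟩ := ne_zero_of_cross_ne_zero h
  have hdet : 0 < P.det := hP.det_pos
  have ha := form_pos_of_posDef hP.inv hp
  have hb := form_pos_of_posDef hP.inv hq
  have hsymm := symm_of_posDef hP
  -- The Gram determinant of p, q in the metric of P⁻¹ is their squared determinant times det P⁻¹.
  -- It yields both strict Cauchy-Schwarz and the sine of the angle.
  have hid : form P⁻¹ p p * form P⁻¹ q q - form P⁻¹ p q ^ 2 = cross p q ^ 2 / P.det := by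
    simp only [form_inv, cross, hsymm]
    have hd : P.det = P 0 0 * P 1 1 - P 1 0 * P 1 0 := by rw [Matrix.det_fin_two, hsymm]
    have key : ∀ A B C X d : ℝ, d ≠ 0 → A * B - C ^ 2 = X ^ 2 * d →
        A / d * (B / d) - (C / d) ^ 2 = X ^ 2 / d := by
      intro A B C X d hd0 hABC
      field_simp
      linarith
    refine key _ _ _ _ _ hdet.ne' ?_
    rw [hd]
    ring
  set a := form P⁻¹ p p
  set b := form P⁻¹ q q
  set c := form P⁻¹ p q
  have hcr : 0 < |cross p q| := abs_pos.2 h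
  have hsab : 0 < √a * √b := mul_pos (Real.sqrt_pos.2 ha) (Real.sqrt_pos.2 hb)
  have hsq : (√a * √b) ^ 2 = a * b := by
    rw [mul_pow, Real.sq_sqrt ha.le, Real.sq_sqrt hb.le]
  have hpos : 0 < cross p q ^ 2 / P.det := by positivity
  have hlt : |c| < √a * √b := by
    refine abs_lt_of_sq_lt_sq ?_ hsab.le
    rw [hsq]; linarith
  obtain ⟨hl, hr⟩ := abs_lt.1 hlt
  have h1 : -1 < c / (√a * √b) := by rw [lt_div_iff₀ hsab]; linarith
  have h2 : c / (√a * √b) < 1 := by rw [div_lt_one hsab]; exact hr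
  refine ⟨Real.arccos_pos.2 h2, Real.arccos_lt_pi.2 h1, ?_⟩
  have hsin : √(1 - (c / (√a * √b)) ^ 2) = |cross p q| / (√P.det * (√a * √b)) := by
    have : 1 - (c / (√a * √b)) ^ 2 = (|cross p q| / (√P.det * (√a * √b))) ^ 2 := by
      rw [div_pow, div_pow, mul_pow √P.det, hsq, Real.sq_sqrt hdet.le, sq_abs]
      have : cross p q ^ 2 = P.det * (a * b - c ^ 2) := by
        rw [hid]; field_simp
      rw [this]
      field_simp
    rw [this, Real.sqrt_sq (by positivity)]
  have hsd : 0 < √P.det := Real.sqrt_pos.2 hdet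
  rw [Real.cot_eq_cos_div_sin, metricAngle, Real.cos_arccos h1.le h2.le, Real.sin_arccos, hsin]
  field_simp

theorem arccot_cot {α : ℝ} (h0 : 0 < α) (hπ : α < Real.pi) : arccot (Real.cot α) = α := by
  have h1 : Real.cot α = Real.tan (Real.pi / 2 - α) := by
    rw [Real.tan_pi_div_two_sub, Real.cot_eq_cos_div_sin, Real.tan_eq_sin_div_cos, inv_div]
  rw [arccot, h1, Real.arctan_tan (by linarith) (by linarith)]
  ring

theorem arccot_lt {s t : ℝ} (h : s < t) : arccot t < arccot s := by
  unfold arccot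
  linarith [Real.arctan_strictMono h]

theorem arccot_neg (t : ℝ) : arccot (-t) = Real.pi - arccot t := by
  unfold arccot
  rw [Real.arctan_neg]
  ring

/-- Division by √δ turns the assumption into √(δ'/δ) cot α' - 2C/√δ < -cot α = cot (π - α), and
arccot is strictly decreasing. -/
theorem pi_sub_lt_arccot {δ δ' α α' C : ℝ} (hδ : 0 < δ) (hδ' : 0 < δ') (h0 : 0 < α)
    (hπ : α < Real.pi) (h : √δ * Real.cot α + √δ' * Real.cot α' < 2 * C) :
    Real.pi - α < arccot (√(δ' / δ) * Real.cot α' - 2 * C / √δ) := by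
  have hs : 0 < √δ := Real.sqrt_pos.2 hδ
  have h1 : Real.pi - α = arccot (-Real.cot α) := by rw [arccot_neg, arccot_cot h0 hπ]
  rw [h1]
  refine arccot_lt ?_
  rw [Real.sqrt_div hδ'.le]
  have : √δ' / √δ * Real.cot α' - 2 * C / √δ = (√δ' * Real.cot α' - 2 * C) / √δ := by ring
  rw [this, div_lt_iff₀ hs]
  linarith

/-- The edge condition, in terms of cotangents. -/
theorem EdgeCondition.le_cot {D : Plane → Matrix (Fin 2) (Fin 2) ℝ} {b : Plane → Plane}
    {c : Plane → ℝ} {i j k k' : Plane} (h : EdgeCondition D b c i j k k')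
    (hδ : 0 < (avg D (tri i j k)).det) (hδ' : 0 < (avg D (tri i j k')).det)
    (h0 : 0 < oppAngle D i j k) (hπ : oppAngle D i j k < Real.pi)
    (h0' : 0 < oppAngle D i j k') (hπ' : oppAngle D i j k' < Real.pi) :
    2 * (perturbation b c i j k + perturbation b c i j k')
      ≤ √(avg D (tri i j k)).det * Real.cot (oppAngle D i j k)
        + √(avg D (tri i j k')).det * Real.cot (oppAngle D i j k') := by
  -- The strict reverse inequality is symmetric in the two elements, so both arccot terms exceed the
  -- supplements of the angles and θ > π.
  by_contra! hlt
  have h1 := pi_sub_lt_arccot hδ hδ' h0 hπ hlt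
  rw [add_comm] at hlt
  have h2 := pi_sub_lt_arccot hδ' hδ h0' hπ' hlt
  have h3 := h.2
  linarith

/-! ### The averaged diffusion matrix -/

namespace Triangulation

variable {Ω : Set Plane} (T : Triangulation Ω)

theorem integrableOn_elem {f : Plane → ℝ} (hf : ContinuousOn f (closure Ω)) {K : Finset Plane}
    (hK : K ∈ T.elems) : IntegrableOn f (convexHull ℝ (K : Set Plane)) :=
  (hf.mono (T.subset_closure hK)).integrableOn_compact (IsTriangle.isCompact_convexHull K)

theorem ae_mem (hreg : interior (closure Ω) = Ω) {K : Finset Plane} (hK : K ∈ T.elems) :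
    ∀ᵐ x ∂(volume.restrict (convexHull ℝ (K : Set Plane))), x ∈ Ω := by
  filter_upwards [IsTriangle.ae_mem_interior K] with x hx using T.interior_subset hreg hK hx

theorem form_avg {D : Plane → Matrix (Fin 2) (Fin 2) ℝ} (hD : ContinuousOn D (closure Ω))
    {K : Finset Plane} (hK : K ∈ T.elems) (x y : Plane) :
    form (avg D (convexHull ℝ (K : Set Plane))) x y
      = ⨍ z in convexHull ℝ (K : Set Plane), form (D z) x y := by
  have hint : ∀ r s : Fin 2, IntegrableOn (fun z => D z r s) (convexHull ℝ (K : Set Plane)) :=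
    fun r s => T.integrableOn_elem ((continuous_apply_apply r s).comp_continuousOn hD) hK
  simp only [form_eq, avg, Matrix.of_apply, setAverage_eq, smul_eq_mul]
  rw [integral_add, integral_const_mul, integral_const_mul, integral_add, integral_add,
    integral_mul_const, integral_mul_const, integral_mul_const, integral_mul_const]
  · ring
  all_goals
    first
      | exact (hint _ _).mul_const _
      | exact (((hint _ _).mul_const _).add ((hint _ _).mul_const _)).const_mul _

/-- D may degenerate on ∂Ω, but the boundary of an element is a null set. So x ↦ xᵀ D_K x averages
an almost everywhere positive function over a set of positive area. -/
theorem posDef_avg (hreg : interior (closure Ω) = Ω) {D : Plane → Matrix (Fin 2) (Fin 2) ℝ}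
    (hD : ContinuousOn D (closure Ω)) (hDpos : ∀ x ∈ Ω, (D x).PosDef) {K : Finset Plane}
    (hK : K ∈ T.elems) : (avg D (convexHull ℝ (K : Set Plane))).PosDef := by
  have hvol : 0 < volume.real (convexHull ℝ (K : Set Plane)) := (T.isTriangle hK).area_pos
  refine posDef_of_form_pos ?_ fun x hx => ?_
  · simp only [avg, Matrix.of_apply, setAverage_eq]
    congr 1
    refine integral_congr_ae ?_
    filter_upwards [T.ae_mem hreg hK] with z hz using symm_of_posDef (hDpos z hz)
  · rw [T.form_avg hD hK, setAverage_eq, smul_eq_mul]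
    refine mul_pos (inv_pos.2 hvol) ?_
    have hcont : ContinuousOn (fun z => form (D z) x x) (closure Ω) := by
      have h : ∀ r s : Fin 2, ContinuousOn (fun z => D z r s) (closure Ω) :=
        fun r s => (continuous_apply_apply r s).comp_continuousOn hD
      simp only [form_eq]
      have h1 := h 0 0
      have h2 := h 0 1
      have h3 := h 1 0
      have h4 := h 1 1
      fun_prop
    have hae : ∀ᵐ z ∂(volume.restrict (convexHull ℝ (K : Set Plane))), 0 < form (D z) x x := by
      filter_upwards [T.ae_mem hreg hK] with z hz using form_pos_of_posDef (hDpos z hz) hx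
    have hnn : 0 ≤ᵐ[volume.restrict (convexHull ℝ (K : Set Plane))] fun z => form (D z) x x := by
      filter_upwards [hae] with z hz using hz.le
    refine lt_of_le_of_ne (integral_nonneg_of_ae hnn) fun h0 => ?_
    have h1 := (integral_eq_zero_iff_of_nonneg_ae hnn (T.integrableOn_elem hcont hK)).1 h0.symm
    have hF : ∀ᵐ z ∂(volume.restrict (convexHull ℝ (K : Set Plane))), False := by
      filter_upwards [hae, h1] with z hz hz'
      rw [hz'] at hz
      exact lt_irrefl _ hz
    rw [eventually_false_iff_eq_bot, ae_eq_bot, Measure.restrict_eq_zero] at hF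
    rw [measureReal_def, hF] at hvol
    simp at hvol

end Triangulation

/-! ### Local stiffness entries -/

/-- The contribution of the element `K` to the bilinear form of the scheme, for the trial function
`u` and the test function `v`. -/
noncomputable def elemForm (D : Plane → Matrix (Fin 2) (Fin 2) ℝ) (b : Plane → Plane)
    (c : Plane → ℝ) (K : Finset Plane) (u v : Plane → ℝ) : ℝ :=
  area (convexHull ℝ (K : Set Plane)) *
      form (avg D (convexHull ℝ (K : Set Plane))) (elemGrad K v) (elemGrad K u)
    + (∫ x in convexHull ℝ (K : Set Plane), v x * inner ℝ (b x) (elemGrad K u))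
    + ∫ x in convexHull ℝ (K : Set Plane), c x * u x * v x

namespace IsTriangle

variable {K : Finset Plane}

/-- The off-diagonal entries of the local stiffness matrix in terms of the angles in the metric of
the inverse diffusion matrix. -/
theorem area_mul_form (hK : IsTriangle K) {i j k : Plane} (h : (K : Set Plane) = {i, j, k})
    {P : Matrix (Fin 2) (Fin 2) ℝ} (hP : P.PosDef) :
    area (convexHull ℝ (K : Set Plane)) * form P (affGrad (bary K i)) (affGrad (bary K j))
      = -(1 / 2) * (√P.det * Real.cot (metricAngle P⁻¹ (i - k) (j - k))) := by
  have hc := hK.cross_ne_zero h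
  rw [(metricAngle_inv hP hc).2.2, hK.area_eq h, form_eq]
  have h' : (K : Set Plane) = {j, i, k} := by rw [h, insert_comm]
  obtain ⟨h1, h2⟩ := hK.affGrad_bary h
  obtain ⟨h3, h4⟩ := hK.affGrad_bary h'
  have hcc : cross (j - k) (i - k) = - cross (i - k) (j - k) := by simp only [cross]; ring
  rw [h1, h2, h3, h4, hcc, form_inv]
  have hd : 0 < P.det := hP.det_pos
  have hsymm := symm_of_posDef hP
  have hs : √P.det * √P.det = P.det := Real.mul_self_sqrt hd.le
  have hX : cross (i - k) (j - k) * cross (i - k) (j - k)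
      = |cross (i - k) (j - k)| * |cross (i - k) (j - k)| := (abs_mul_abs_self _).symm
  have hA : 0 < |cross (i - k) (j - k)| := abs_pos.2 hc
  set X := cross (i - k) (j - k)
  set N := (i - k) 0 * (P 1 1 * (j - k) 0 - P 0 1 * (j - k) 1)
    + (i - k) 1 * (P 0 0 * (j - k) 1 - P 1 0 * (j - k) 0) with hN
  have hr : √P.det * (N / P.det * √P.det / |X|) = N / |X| := by
    calc √P.det * (N / P.det * √P.det / |X|) = N / P.det * (√P.det * √P.det) / |X| := by ring
      _ = N / |X| := by rw [hs, div_mul_cancel₀ _ hd.ne']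
  rw [hr]
  -- Both gradients are sides turned by a right angle. This turn conjugates P to its adjugate, so
  -- the form of P becomes the numerator N of the form of P⁻¹; the minus sign comes from the
  -- opposite orientations of the two pairs of sides.
  have hl : (j - k) 1 / X * (P 0 0 * ((i - k) 1 / -X) + P 0 1 * (-(i - k) 0 / -X))
      + -(j - k) 0 / X * (P 1 0 * ((i - k) 1 / -X) + P 1 1 * (-(i - k) 0 / -X)) = -N / (X * X) := by
    rw [hN, hsymm]
    field_simp
    ring
  rw [hl, hX]
  field_simp

/-- The coordinate of j is 1 at j, 0 on the line through i and k, and has slope ‖g‖ along its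
gradient g. The foot of the height is j - g/‖g‖², and Cauchy-Schwarz shows that no point of the line
is nearer. -/
theorem height_eq (hK : IsTriangle K) {i j k : Plane} (h : (K : Set Plane) = {i, j, k}) :
    0 < ‖affGrad (bary K j)‖ ∧ height i j k = ‖affGrad (bary K j)‖⁻¹ := by
  have hij := hK.ne_of_coe_eq h
  have hiK : i ∈ K := by rw [← Finset.mem_coe, h]; simp
  have hjK : j ∈ K := by rw [← Finset.mem_coe, h]; simp
  have hkK : k ∈ K := by rw [← Finset.mem_coe, h]; simp
  set g := affGrad (bary K j) with hg
  have hlin : ∀ x y : Plane, bary K j x - bary K j y = inner ℝ g (x - y) := fun x y => by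
    rw [hg, inner_affGrad, ← vsub_eq_sub x y, AffineMap.linearMap_vsub, vsub_eq_sub]
  have hj := hK.bary_self hjK
  have hi := hK.bary_of_ne hiK hij.1.symm
  have hk := hK.bary_of_ne hkK hij.2.2
  have hgpos : 0 < ‖g‖ := by
    rw [norm_pos_iff]
    intro h0
    have := hlin j i
    rw [h0, hj, hi, inner_zero_left] at this
    norm_num at this
  refine ⟨hgpos, le_antisymm ?_ ?_⟩
  · set y := j - (‖g‖ ^ 2)⁻¹ • g with hy
    have hy0 : bary K j y = 0 := by
      have := hlin j y
      rw [hj, hy, sub_sub_cancel, inner_smul_right, real_inner_self_eq_norm_sq,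
        inv_mul_cancel₀ (by positivity), ← hy] at this
      linarith
    have hmem : y ∈ affineSpan ℝ ({i, k} : Set Plane) := by
      have hs := hK.sub_eq h y
      rw [hy0, zero_smul, add_zero] at hs
      have : y = AffineMap.lineMap k i (bary K i y) := by
        rw [AffineMap.lineMap_apply, vsub_eq_sub, vadd_eq_add, ← hs, sub_add_cancel]
      rw [this, pair_comm]
      exact AffineMap.lineMap_mem_affineSpan_pair _ _ _
    refine (Metric.infDist_le_dist_of_mem hmem).trans_eq ?_
    rw [dist_eq_norm, hy, sub_sub_cancel, norm_smul, norm_inv, norm_pow, norm_norm]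
    field_simp
  · rw [height, Metric.le_infDist ⟨i, left_mem_affineSpan_pair ℝ i k⟩]
    intro y hy
    obtain ⟨r, rfl⟩ := (mem_affineSpan_pair_iff_exists_lineMap_eq).1 hy
    have hy0 : bary K j (AffineMap.lineMap i k r) = 0 := by
      rw [AffineMap.apply_lineMap, hi, hk]; simp
    have h1 := hlin j (AffineMap.lineMap i k r)
    rw [hj, hy0, sub_zero] at h1
    have h2 := real_inner_le_norm g (j - AffineMap.lineMap i k r)
    rw [← h1] at h2
    rw [dist_eq_norm, inv_le_iff_one_le_mul₀' hgpos]
    exact h2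

end IsTriangle

/-- The diffusion term is exact. Convection is at most ‖b‖ ‖∇φ_j‖ ∫ φ_i with ∫ φ_i = |K|/3 and
‖∇φ_j‖ = 1/h_j; reaction is at most max c · ∫ φ_i φ_j with ∫ φ_i φ_j = |K|/12. -/
theorem Triangulation.elemForm_hat_le {Ω : Set Plane} (T : Triangulation Ω)
    (hreg : interior (closure Ω) = Ω) {D : Plane → Matrix (Fin 2) (Fin 2) ℝ} {b : Plane → Plane}
    {c : Plane → ℝ} (hD : ContinuousOn D (closure Ω)) (hb : ContinuousOn b (closure Ω))
    (hc : ContinuousOn c (closure Ω)) (hDpos : ∀ x ∈ Ω, (D x).PosDef) {K : Finset Plane}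
    (hK : K ∈ T.elems) {i j k : Plane} (h : (K : Set Plane) = {i, j, k}) :
    elemForm D b c K (T.hat j) (T.hat i)
      ≤ -(1 / 2) * (√(avg D (tri i j k)).det * Real.cot (oppAngle D i j k))
        + perturbation b c i j k := by
  have hT := T.isTriangle hK
  have htri : tri i j k = convexHull ℝ (K : Set Plane) := by rw [tri, h]
  have hcpt := IsTriangle.isCompact_convexHull K
  have hmeas := hcpt.isClosed.measurableSet
  have hsub := T.subset_closure hK
  have hP := T.posDef_avg hreg hD hDpos hK
  have hgi : elemGrad K (T.hat i) = affGrad (bary K i) :=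
    hT.elemGrad_eq fun x hx => T.hat_eq_bary hK hx i
  have hgj : elemGrad K (T.hat j) = affGrad (bary K j) :=
    hT.elemGrad_eq fun x hx => T.hat_eq_bary hK hx j
  obtain ⟨hgpos, hheight⟩ := hT.height_eq h
  have hbci := IsTriangle.continuous_bary K i
  have hbcj := IsTriangle.continuous_bary K j
  have hbK := hb.mono hsub
  have hcK := hc.mono hsub
  rw [elemForm, perturbation, oppAngle, htri, hgi, hgj, hT.area_mul_form h hP, add_assoc]
  refine add_le_add le_rfl (add_le_add ?_ ?_)
  · set B := sSup ((fun x => ‖b x‖) '' convexHull ℝ (K : Set Plane)) with hB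
    have hbound : ∀ x ∈ convexHull ℝ (K : Set Plane), ‖b x‖ ≤ B := fun x hx =>
      le_csSup (hcpt.image_of_continuousOn hbK.norm).bddAbove (mem_image_of_mem _ hx)
    have hle : ∫ x in convexHull ℝ (K : Set Plane), T.hat i x * inner ℝ (b x) (affGrad (bary K j))
        ≤ ∫ x in convexHull ℝ (K : Set Plane), bary K i x * (B * ‖affGrad (bary K j)‖) := by
      refine setIntegral_mono_on ?_ ?_ hmeas fun x hx => ?_
      · refine ContinuousOn.integrableOn_compact hcpt ?_
        exact ((T.isP1_hat i).1.mono hsub).mul (hbK.inner continuousOn_const)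
      · exact ContinuousOn.integrableOn_compact hcpt (by fun_prop)
      · rw [T.hat_eq_bary hK hx]
        refine mul_le_mul_of_nonneg_left ?_ (hT.bary_nonneg hx i)
        exact (real_inner_le_norm _ _).trans
          (mul_le_mul_of_nonneg_right (hbound x hx) (norm_nonneg _))
    refine hle.trans_eq ?_
    rw [integral_mul_const, hT.integral_bary_left h, hheight]
    field_simp
    ring
  · set B := sSup (c '' convexHull ℝ (K : Set Plane)) with hB
    have hbound : ∀ x ∈ convexHull ℝ (K : Set Plane), c x ≤ B := fun x hx =>
      le_csSup (hcpt.image_of_continuousOn hcK).bddAbove (mem_image_of_mem _ hx)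
    have hle : ∫ x in convexHull ℝ (K : Set Plane), c x * T.hat j x * T.hat i x
        ≤ ∫ x in convexHull ℝ (K : Set Plane), bary K i x * bary K j x * B := by
      refine setIntegral_mono_on ?_ ?_ hmeas fun x hx => ?_
      · refine ContinuousOn.integrableOn_compact hcpt ?_
        exact (hcK.mul ((T.isP1_hat j).1.mono hsub)).mul ((T.isP1_hat i).1.mono hsub)
      · exact ContinuousOn.integrableOn_compact hcpt (by fun_prop)
      · rw [T.hat_eq_bary hK hx, T.hat_eq_bary hK hx]
        have := mul_le_mul_of_nonneg_left (hbound x hx)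
          (mul_nonneg (hT.bary_nonneg hx i) (hT.bary_nonneg hx j))
        linarith
    refine hle.trans_eq ?_
    rw [integral_mul_const, hT.integral_bary_mul_bary h]
    ring

theorem IsTriangle.exists_third {K : Finset Plane} (hK : IsTriangle K) {i j : Plane} (hi : i ∈ K)
    (hj : j ∈ K) (hij : i ≠ j) : ∃ k, (K : Set Plane) = {i, j, k} := by
  classical
  have hj' : j ∈ K.erase i := Finset.mem_erase.2 ⟨hij.symm, hj⟩
  have hcard : ((K.erase i).erase j).card = 1 := by
    rw [Finset.card_erase_of_mem hj', Finset.card_erase_of_mem hi, hK.1]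
  obtain ⟨k, hk⟩ := Finset.card_eq_one.1 hcard
  refine ⟨k, ?_⟩
  have : K = insert i (insert j {k}) := by
    rw [← hk, Finset.insert_erase hj', Finset.insert_erase hi]
  rw [this]
  simp

/-! ### The two elements at an interior edge and the sign of the off-diagonal entries -/

namespace Triangulation

variable {Ω : Set Plane} (T : Triangulation Ω)

theorem bary_midpoint {K : Finset Plane} (hK : IsTriangle K) {i j k : Plane}
    (h : (K : Set Plane) = {i, j, k}) : bary K i (midpoint ℝ i j) = 1 / 2 ∧
      bary K j (midpoint ℝ i j) = 1 / 2 ∧ bary K k (midpoint ℝ i j) = 0 := by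
  have hiK : i ∈ K := by rw [← Finset.mem_coe, h]; simp
  have hjK : j ∈ K := by rw [← Finset.mem_coe, h]; simp
  obtain ⟨hij, hik, hjk⟩ := hK.ne_of_coe_eq h
  simp only [midpoint, bary_lineMap, hK.bary_self hiK, hK.bary_self hjK, hK.bary_of_ne hjK hij,
    hK.bary_of_ne hiK hij.symm, hK.bary_of_ne hiK hik.symm, hK.bary_of_ne hjK hjk.symm]
  norm_num

theorem cross_third {K : Finset Plane} (hK : IsTriangle K) {i j k : Plane}
    (h : (K : Set Plane) = {i, j, k}) (x : Plane) :
    cross (x - i) (j - i) = bary K k x * cross (k - i) (j - i) ∧ cross (k - i) (j - i) ≠ 0 := by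
  have h' : (K : Set Plane) = {k, j, i} := by
    rw [h, insert_comm, pair_comm, insert_comm, pair_comm, insert_comm]
  exact ⟨hK.cross_eq h' x, hK.cross_ne_zero h'⟩

/-- Two elements that lie on the same side of a common edge coincide. -/
theorem eq_of_same_side {K K' : Finset Plane} (hK : K ∈ T.elems) (hK' : K' ∈ T.elems)
    {i j k k' : Plane} (h : (K : Set Plane) = {i, j, k}) (h' : (K' : Set Plane) = {i, j, k'})
    (hs : 0 < cross (k - i) (j - i) * cross (k' - i) (j - i)) : K = K' := by
  have hT := T.isTriangle hK
  have hT' := T.isTriangle hK'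
  obtain ⟨hi, hj, hk⟩ := bary_midpoint hT h
  obtain ⟨hi', hj', hk'⟩ := bary_midpoint hT' h'
  have hkK : k ∈ K := by rw [← Finset.mem_coe, h]; simp
  obtain ⟨hij, hik, hjk⟩ := hT.ne_of_coe_eq h
  set m := midpoint ℝ i j
  have hline := tendsto_lineMap_zero m k
  have hpos : ∀ a, bary K' a m = 1 / 2 →
      ∀ᶠ t : ℝ in 𝓝 0, 0 < bary K' a (AffineMap.lineMap m k t) := by
    intro a ha
    refine (((IsTriangle.continuous_bary K' a).tendsto m).comp hline).eventually (lt_mem_nhds ?_)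
    rw [ha]; norm_num
  have h01 : ∀ᶠ t : ℝ in 𝓝[>] 0, t ∈ Ioo (0 : ℝ) 1 := Ioo_mem_nhdsGT one_pos
  -- A point slightly off the midpoint of the edge towards k lies in both elements. Its k-coordinate
  -- is positive, so conformity makes k a vertex of K'.
  obtain ⟨t, ⟨hti, htj⟩, ht0, ht1⟩ :=
    ((((hpos i hi').and (hpos j hj')).filter_mono nhdsWithin_le_nhds).and h01).exists
  set y : Plane := AffineMap.lineMap m k t with hy
  have hky : bary K k y = t := by
    rw [hy, bary_lineMap, hk, hT.bary_self hkK]; ring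
  have hyK : y ∈ convexHull ℝ (K : Set Plane) := by
    rw [hT.mem_convexHull_iff]
    intro a ha
    rw [← Finset.mem_coe, h] at ha
    rcases ha with rfl | rfl | rfl
    · rw [hy, bary_lineMap, hi, hT.bary_of_ne hkK hik]; linarith
    · rw [hy, bary_lineMap, hj, hT.bary_of_ne hkK hjk]; linarith
    · rw [hky]; exact ht0.le
  have hk'y : 0 ≤ bary K' k' y := by
    have h1 := (cross_third hT h y).1
    rw [(cross_third hT' h' y).1, hky] at h1
    have h2 : bary K' k' y * (cross (k' - i) (j - i) * cross (k' - i) (j - i))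
        = t * (cross (k - i) (j - i) * cross (k' - i) (j - i)) := by
      rw [← mul_assoc, h1]; ring
    have h3 := mul_self_pos.2 (cross_third hT' h' y).2
    by_contra! hneg
    have h4 := mul_neg_of_neg_of_pos hneg h3
    have h5 := mul_pos ht0 hs
    linarith
  have hyK' : y ∈ convexHull ℝ (K' : Set Plane) := by
    rw [hT'.mem_convexHull_iff]
    intro a ha
    rw [← Finset.mem_coe, h'] at ha
    rcases ha with rfl | rfl | rfl
    · exact hti.le
    · exact htj.le
    · exact hk'y
  have hkK' : k ∈ K' := T.mem_of_bary_ne_zero hK hK' hyK hyK' (by rw [hky]; exact ht0.ne')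
  rw [← Finset.mem_coe, h'] at hkK'
  rcases hkK' with h1 | h1 | h1
  · exact absurd h1.symm hik
  · exact absurd h1.symm hjk
  · rw [mem_singleton_iff] at h1
    rw [← Finset.coe_inj, h, h', h1]

/-- An edge with an end point in the domain has elements on both of its sides. -/
theorem exists_other_side (hreg : interior (closure Ω) = Ω) {K : Finset Plane} (hK : K ∈ T.elems)
    {i j k : Plane} (h : (K : Set Plane) = {i, j, k}) (hiΩ : i ∈ Ω) :
    ∃ L ∈ T.elems, ∃ l, (L : Set Plane) = {i, j, l} ∧
      cross (k - i) (j - i) * cross (l - i) (j - i) < 0 := by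
  have hT := T.isTriangle hK
  obtain ⟨hi, hj, hk⟩ := bary_midpoint hT h
  have hiK : i ∈ K := by rw [← Finset.mem_coe, h]; simp
  have hjK : j ∈ K := by rw [← Finset.mem_coe, h]; simp
  have hkK : k ∈ K := by rw [← Finset.mem_coe, h]; simp
  obtain ⟨hij, hik, hjk⟩ := hT.ne_of_coe_eq h
  set m := midpoint ℝ i j
  have hΩ : IsOpen Ω := hreg ▸ isOpen_interior
  have hmK : m ∈ convexHull ℝ (K : Set Plane) := by
    rw [hT.mem_convexHull_iff]
    intro a ha
    rw [← Finset.mem_coe, h] at ha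
    rcases ha with rfl | rfl | rfl
    · rw [hi]; norm_num
    · rw [hj]; norm_num
    · rw [hk]
  have hmΩ : m ∈ Ω := T.mem_of_bary_pos hreg hK hiK hiΩ hmK (by rw [hi]; norm_num)
  have hline := tendsto_lineMap_zero m k
  have hev : ∀ L ∈ T.elems, ∀ᶠ t : ℝ in 𝓝 0,
      (AffineMap.lineMap m k t : Plane) ∈ convexHull ℝ (L : Set Plane) →
        m ∈ convexHull ℝ (L : Set Plane) := by
    intro L _
    by_cases hm : m ∈ convexHull ℝ (L : Set Plane)
    · exact Eventually.of_forall fun _ _ => hm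
    · have hop : IsOpen (convexHull ℝ (L : Set Plane))ᶜ :=
        (IsTriangle.isCompact_convexHull L).isClosed.isOpen_compl
      filter_upwards [hline.eventually (hop.mem_nhds hm)] with t ht ht'
      exact absurd ht' ht
  have hall := (Finset.eventually_all T.elems).2 hev
  have hneg : ∀ᶠ t : ℝ in 𝓝[<] 0, t < 0 := eventually_mem_nhdsWithin
  -- Step from the midpoint m away from k, which is where t < 0. Since m is in Ω, some element L
  -- contains the new point; for small |t| it also contains m, hence has i and j as vertices.
  obtain ⟨t, ⟨hm, htΩ⟩, ht0⟩ :=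
    (((hall.and (hline.eventually (hΩ.mem_nhds hmΩ))).filter_mono nhdsWithin_le_nhds).and
      hneg).exists
  obtain ⟨L, hL, htL⟩ := T.exists_elem (_root_.subset_closure htΩ)
  have hmL := hm L hL htL
  have hiL : i ∈ L := T.mem_of_bary_ne_zero hK hL hmK hmL (by rw [hi]; norm_num)
  have hjL : j ∈ L := T.mem_of_bary_ne_zero hK hL hmK hmL (by rw [hj]; norm_num)
  have hT' := T.isTriangle hL
  obtain ⟨l, hl⟩ := hT'.exists_third hiL hjL hij
  refine ⟨L, hL, l, hl, ?_⟩
  set y : Plane := AffineMap.lineMap m k t with hy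
  have hky : bary K k y = t := by
    rw [hy, bary_lineMap, hk, hT.bary_self hkK]; ring
  have h1 := (cross_third hT h y).1
  obtain ⟨h2, h3⟩ := cross_third hT' hl y
  rw [hky] at h1
  have h4 := hT'.bary_nonneg htL l
  have h5 := (cross_third hT h y).2
  have h6 : bary L l y * (cross (l - i) (j - i) * cross (l - i) (j - i))
      = t * (cross (k - i) (j - i) * cross (l - i) (j - i)) := by
    rw [← mul_assoc, ← h2, h1]; ring
  have h7 : 0 ≤ t * (cross (k - i) (j - i) * cross (l - i) (j - i)) :=
    h6 ▸ mul_nonneg h4 (mul_self_nonneg _)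
  refine lt_of_le_of_ne ?_ (mul_ne_zero h5 h3)
  by_contra! h8
  linarith [mul_neg_of_neg_of_pos ht0 h8]

/-- Of three elements on one edge two would lie on the same side and coincide. So only K and its
neighbour across the edge contribute. -/
theorem sum_edge (hreg : interior (closure Ω) = Ω) {K : Finset Plane} (hK : K ∈ T.elems)
    {i j k : Plane} (h : (K : Set Plane) = {i, j, k}) (hiΩ : i ∈ Ω) :
    ∃ L ∈ T.elems, ∃ l, (L : Set Plane) = {i, j, l} ∧ k ≠ l ∧
      ∀ f : Finset Plane → ℝ, (∀ M ∈ T.elems, i ∉ M ∨ j ∉ M → f M = 0) →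
        ∑ M ∈ T.elems, f M = f K + f L := by
  classical
  obtain ⟨L, hL, l, hl, hneg⟩ := T.exists_other_side hreg hK h hiΩ
  have hkl : k ≠ l := by
    rintro rfl
    exact absurd hneg (not_lt.2 (mul_self_nonneg _))
  have hKL : K ≠ L := by
    rintro rfl
    have hk : k ∈ (K : Set Plane) := by rw [h]; simp
    obtain ⟨hij, hik, hjk⟩ := (T.isTriangle hK).ne_of_coe_eq h
    rw [hl] at hk
    rcases hk with h1 | h1 | h1
    · exact hik h1.symm
    · exact hjk h1.symm
    · exact hkl h1
  refine ⟨L, hL, l, hl, hkl, fun f hf => ?_⟩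
  rw [← Finset.sum_pair hKL]
  symm
  refine Finset.sum_subset (by intro M; simp; rintro (rfl | rfl) <;> assumption) fun M hM hMn => ?_
  refine hf M hM ?_
  by_contra! hij'
  obtain ⟨m, hm⟩ := (T.isTriangle hM).exists_third hij'.1 hij'.2 ((T.isTriangle hK).ne_of_coe_eq h).1
  simp only [Finset.mem_insert, Finset.mem_singleton, not_or] at hMn
  have h1 : cross (m - i) (j - i) ≠ 0 := (cross_third (T.isTriangle hM) hm m).2
  have h2 : ¬ 0 < cross (m - i) (j - i) * cross (k - i) (j - i) := fun hs =>
    hMn.1 (T.eq_of_same_side hM hK hm h hs)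
  have h3 : ¬ 0 < cross (m - i) (j - i) * cross (l - i) (j - i) := fun hs =>
    hMn.2 (T.eq_of_same_side hM hL hm hl hs)
  push Not at h2 h3
  have h4 := mul_nonneg_of_nonpos_of_nonpos h2 h3
  have h5 := mul_neg_of_pos_of_neg (mul_self_pos.2 h1) hneg
  nlinarith

theorem elemForm_hat_eq_zero {D : Plane → Matrix (Fin 2) (Fin 2) ℝ} {b : Plane → Plane}
    {c : Plane → ℝ} {i j : Plane} {K : Finset Plane} (hK : K ∈ T.elems) (h : i ∉ K ∨ j ∉ K) :
    elemForm D b c K (T.hat j) (T.hat i) = 0 := by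
  have hcpt := IsTriangle.isCompact_convexHull K
  have hmeas := hcpt.isClosed.measurableSet
  have hz : ∀ a ∉ K, (∀ x ∈ convexHull ℝ (K : Set Plane), T.hat a x = 0)
      ∧ elemGrad K (T.hat a) = 0 := by
    intro a ha
    constructor
    · intro x hx
      rw [T.hat_eq_bary hK hx, IsTriangle.bary_of_notMem ha]; rfl
    · rw [(T.isTriangle hK).elemGrad_eq fun x hx => T.hat_eq_bary hK hx a,
        IsTriangle.affGrad_bary_of_notMem ha]
  have hfl : ∀ (M : Matrix (Fin 2) (Fin 2) ℝ) (x : Plane), form M 0 x = 0 ∧ form M x 0 = 0 :=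
    fun M x => by simp [form_eq]
  rw [elemForm]
  rcases h with h | h
  · obtain ⟨h1, h2⟩ := hz i h
    rw [h2, (hfl _ _).1, setIntegral_eq_zero_of_forall_eq_zero fun x hx => by rw [h1 x hx, zero_mul],
      setIntegral_eq_zero_of_forall_eq_zero fun x hx => by rw [h1 x hx, mul_zero]]
    simp
  · obtain ⟨h1, h2⟩ := hz j h
    rw [h2, (hfl _ _).2, setIntegral_eq_zero_of_forall_eq_zero fun x hx => by
        rw [inner_zero_right, mul_zero],
      setIntegral_eq_zero_of_forall_eq_zero fun x hx => by rw [h1 x hx, mul_zero, zero_mul]]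
    simp

theorem posDef_avg_tri (hreg : interior (closure Ω) = Ω) {D : Plane → Matrix (Fin 2) (Fin 2) ℝ}
    (hD : ContinuousOn D (closure Ω)) (hDpos : ∀ x ∈ Ω, (D x).PosDef) {K : Finset Plane}
    (hK : K ∈ T.elems) {i j k : Plane} (h : (K : Set Plane) = {i, j, k}) :
    (avg D (tri i j k)).PosDef := by
  rw [tri, ← h]; exact T.posDef_avg hreg hD hDpos hK

/-- The off-diagonal entries of the stiffness matrix are nonpositive. -/
theorem sum_elemForm_hat_nonpos (hreg : interior (closure Ω) = Ω)
    {D : Plane → Matrix (Fin 2) (Fin 2) ℝ} {b : Plane → Plane} {c : Plane → ℝ}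
    (hD : ContinuousOn D (closure Ω)) (hb : ContinuousOn b (closure Ω))
    (hc : ContinuousOn c (closure Ω)) (hDpos : ∀ x ∈ Ω, (D x).PosDef)
    (hedge : ∀ i j k k' : Plane, T.InternalEdge i j k k' → EdgeCondition D b c i j k k')
    {i j : Plane} (hi : i ∈ Ω) (hij : i ≠ j) :
    ∑ K ∈ T.elems, elemForm D b c K (T.hat j) (T.hat i) ≤ 0 := by
  by_cases hex : ∃ K ∈ T.elems, i ∈ K ∧ j ∈ K
  · obtain ⟨K, hK, hiK, hjK⟩ := hex
    obtain ⟨k, hk⟩ := (T.isTriangle hK).exists_third hiK hjK hij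
    obtain ⟨L, hL, l, hl, hkl, hsum⟩ := T.sum_edge hreg hK hk hi
    rw [hsum _ fun M hM h => T.elemForm_hat_eq_zero hM h]
    have hPK := T.posDef_avg_tri hreg hD hDpos hK hk
    have hPL := T.posDef_avg_tri hreg hD hDpos hL hl
    have hint : T.InternalEdge i j k l := by
      refine ⟨hi, hkl, ?_, ?_⟩
      · convert hK
        rw [← Finset.coe_inj, hk]; simp
      · convert hL
        rw [← Finset.coe_inj, hl]; simp
    have haK := metricAngle_inv hPK ((T.isTriangle hK).cross_ne_zero hk)
    have haL := metricAngle_inv hPL ((T.isTriangle hL).cross_ne_zero hl)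
    -- The two element bounds add up to -½ (√δ cot α + √δ' cot α') + C, which is nonpositive by this
    -- inequality.
    have h1 := (hedge i j k l hint).le_cot hPK.det_pos hPL.det_pos haK.1 haK.2.1 haL.1 haL.2.1
    have h2 := T.elemForm_hat_le hreg hD hb hc hDpos hK hk
    have h3 := T.elemForm_hat_le hreg hD hb hc hDpos hL hl
    linarith
  · push Not at hex
    refine (Finset.sum_eq_zero fun K hK => T.elemForm_hat_eq_zero hK ?_).le
    by_cases hiK : i ∈ K
    · exact Or.inr (hex K hK hiK)
    · exact Or.inl hiK

end Triangulation

/-! ### Global Lipschitz continuity of finite element functions extended by zero -/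

/-- A function on the line with a finite closed cover of an interval on whose members it is
`L`-Lipschitz satisfies the Lipschitz estimate between the end points. -/
theorem abs_sub_le_of_finite_cover {ι : Type*} {A : ι → Set ℝ} {f : ℝ → ℝ} {L y : ℝ} (n : ℕ) :
    ∀ (s : Finset ι), s.card = n → (∀ i ∈ s, IsClosed (A i)) →
      (∀ i ∈ s, ∀ a ∈ A i, ∀ a' ∈ A i, |f a - f a'| ≤ L * |a - a'|) →
      ∀ x ≤ y, Icc x y ⊆ ⋃ i ∈ s, A i → |f x - f y| ≤ L * |x - y| := by
  classical
  induction n with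
  | zero =>
    intro s hs _ _ x hxy hcov
    rw [Finset.card_eq_zero] at hs
    have := hcov (left_mem_Icc.2 hxy)
    simp [hs] at this
  | succ n ih =>
    intro s hs hcl hlip x hxy hcov
    obtain ⟨i, hi, hxi⟩ : ∃ i ∈ s, x ∈ A i := by simpa using hcov (left_mem_Icc.2 hxy)
    have hcpt : IsCompact (A i ∩ Icc x y) := isCompact_Icc.inter_left (hcl i hi)
    -- Take the last point z of `A i` in [x, y]. The remaining sets cover (z, y], hence by
    -- closedness [z, y], and the induction applies there.
    obtain ⟨z, ⟨hzA, hxz, hzy⟩, hmax⟩ := hcpt.exists_isGreatest ⟨x, hxi, left_mem_Icc.2 hxy⟩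
    have h1 := hlip i hi x hxi z hzA
    rcases eq_or_lt_of_le hzy with rfl | hlt
    · exact h1
    have hsub : Ioc z y ⊆ ⋃ j ∈ s.erase i, A j := by
      rintro t ⟨hzt, hty⟩
      obtain ⟨j, hj, htj⟩ : ∃ j ∈ s, t ∈ A j := by simpa using hcov ⟨hxz.trans hzt.le, hty⟩
      refine mem_biUnion (x := j) (Finset.mem_erase.2 ⟨?_, hj⟩) htj
      rintro rfl
      exact absurd (hmax ⟨htj, hxz.trans hzt.le, hty⟩) (not_le.2 hzt)
    have hclosed : IsClosed (⋃ j ∈ s.erase i, A j) :=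
      (s.erase i).finite_toSet.isClosed_biUnion fun j hj => hcl j (Finset.mem_of_mem_erase hj)
    have hcov' : Icc z y ⊆ ⋃ j ∈ s.erase i, A j := by
      rw [← closure_Ioc hlt.ne]
      exact closure_minimal hsub hclosed
    have h2 := ih (s.erase i) (by rw [Finset.card_erase_of_mem hi, hs]; rfl)
      (fun j hj => hcl j (Finset.mem_of_mem_erase hj))
      (fun j hj => hlip j (Finset.mem_of_mem_erase hj)) z hzy hcov'
    have h3 : |x - y| = |x - z| + |z - y| := by
      rw [abs_of_nonpos (by linarith), abs_of_nonpos (by linarith), abs_of_nonpos (by linarith)]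
      ring
    rw [h3, mul_add]
    exact (abs_sub_le _ (f z) _).trans (add_le_add h1 h2)

theorem abs_sub_le_of_finite_cover_plane {ι : Type*} {s : Finset ι} {A : ι → Set Plane}
    {w : Plane → ℝ} {L : ℝ} (hcl : ∀ i ∈ s, IsClosed (A i)) (hcov : ∀ x, ∃ i ∈ s, x ∈ A i)
    (hlip : ∀ i ∈ s, ∀ x ∈ A i, ∀ y ∈ A i, |w x - w y| ≤ L * ‖x - y‖) (x y : Plane) :
    |w x - w y| ≤ L * ‖x - y‖ := by
  have h := abs_sub_le_of_finite_cover (A := fun i => (fun t : ℝ => AffineMap.lineMap x y t) ⁻¹' A i)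
    (f := fun t => w (AffineMap.lineMap x y t)) (L := L * ‖x - y‖) (y := 1) s.card s rfl
    (fun i hi => (hcl i hi).preimage AffineMap.lineMap_continuous) ?_ 0 zero_le_one ?_
  · simpa using h
  · intro i hi a ha a' ha'
    refine (hlip i hi _ ha _ ha').trans_eq ?_
    rw [← dist_eq_norm, dist_lineMap_lineMap, dist_eq_norm x y, Real.dist_eq]
    ring
  · intro t _
    obtain ⟨i, hi, hti⟩ := hcov (AffineMap.lineMap x y t)
    exact mem_biUnion (x := i) hi hti

namespace Triangulation

variable {Ω : Set Plane} {T : Triangulation Ω} {w : Plane → ℝ}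

theorem IsP1.hasGradientAt (hw : T.IsP1 w) {K : Finset Plane} (hK : K ∈ T.elems) {x : Plane}
    (hx : x ∈ interior (convexHull ℝ (K : Set Plane))) : HasGradientAt w (elemGrad K w) x := by
  obtain ⟨l, hl⟩ := hw.2 K hK
  rw [(T.isTriangle hK).elemGrad_eq hl]
  refine (hasGradientAt_affine l x).congr_of_eventuallyEq ?_
  filter_upwards [mem_interior_iff_mem_nhds.1 hx] with y hy using hl hy

/-- A linear finite element function that vanishes outside the domain is Lipschitz continuous on
the plane. -/
theorem IsP1.abs_sub_le (hw : T.IsP1 w) (hreg : interior (closure Ω) = Ω)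
    (hw0 : ∀ x ∉ Ω, w x = 0) (x y : Plane) :
    |w x - w y| ≤ (∑ K ∈ T.elems, ‖elemGrad K w‖) * ‖x - y‖ := by
  classical
  have hΩ : IsOpen Ω := hreg ▸ isOpen_interior
  -- The finite closed cover consists of the elements and, under the index `none`, of the complement
  -- of Ω, where w = 0.
  refine abs_sub_le_of_finite_cover_plane (s := insert none (T.elems.image some))
    (A := fun o : Option (Finset Plane) => o.elim Ωᶜ fun K => convexHull ℝ (K : Set Plane))
    ?_ ?_ ?_ x y
  · intro o ho
    rcases Finset.mem_insert.1 ho with rfl | ho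
    · exact hΩ.isClosed_compl
    · obtain ⟨K, hK, rfl⟩ := Finset.mem_image.1 ho
      exact (IsTriangle.isCompact_convexHull K).isClosed
  · intro z
    by_cases hz : z ∈ Ω
    · obtain ⟨K, hK, hzK⟩ := T.exists_elem (_root_.subset_closure hz)
      exact ⟨some K, by simp [hK], hzK⟩
    · exact ⟨none, by simp, hz⟩
  · intro o ho
    have hnn : 0 ≤ ∑ K ∈ T.elems, ‖elemGrad K w‖ := Finset.sum_nonneg fun _ _ => norm_nonneg _
    rcases Finset.mem_insert.1 ho with rfl | ho
    · intro a ha a' ha'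
      rw [hw0 a ha, hw0 a' ha', sub_self, abs_zero]
      positivity
    · obtain ⟨K, hK, rfl⟩ := Finset.mem_image.1 ho
      intro a ha a' ha'
      obtain ⟨l, hl⟩ := hw.2 K hK
      have h1 : w a - w a' = inner ℝ (elemGrad K w) (a - a') := by
        rw [hl ha, hl ha', (T.isTriangle hK).elemGrad_eq hl, inner_affGrad, ← vsub_eq_sub a a',
          AffineMap.linearMap_vsub, vsub_eq_sub]
      rw [h1]
      refine (abs_real_inner_le_norm _ _).trans ?_
      refine mul_le_mul_of_nonneg_right ?_ (norm_nonneg _)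
      exact Finset.single_le_sum (f := fun K => ‖elemGrad K w‖) (fun _ _ => norm_nonneg _) hK

theorem exists_notMem (T : Triangulation Ω) : ∃ x, x ∉ Ω := by
  by_contra! h
  have hu : closure Ω = univ := by rw [eq_univ_of_forall h, closure_univ]
  exact noncompact_univ Plane (hu ▸ T.isCompact_closure)

/-- The Lipschitz constant is zero, so w is constant on the plane, and it vanishes at a point
outside the bounded set Ω. -/
theorem IsP1.eq_zero_of_elemGrad (hw : T.IsP1 w) (hreg : interior (closure Ω) = Ω)
    (hw0 : ∀ x ∉ Ω, w x = 0) (hg : ∀ K ∈ T.elems, elemGrad K w = 0) (x : Plane) : w x = 0 := by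
  obtain ⟨y, hy⟩ := T.exists_notMem
  have h := hw.abs_sub_le hreg hw0 x y
  rw [Finset.sum_eq_zero fun K hK => by rw [hg K hK, norm_zero], zero_mul, hw0 y hy, sub_zero] at h
  exact abs_nonpos_iff.1 h

end Triangulation

/-! ### Truncation, integration by parts and coercivity -/

theorem hasDerivAt_max_zero_sq (t : ℝ) : HasDerivAt (fun s : ℝ => max s 0 ^ 2) (2 * max t 0) t := by
  rcases lt_trichotomy t 0 with h | rfl | h
  · rw [max_eq_right h.le, mul_zero]
    refine (hasDerivAt_const t (0 : ℝ)).congr_of_eventuallyEq ?_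
    filter_upwards [gt_mem_nhds h] with s hs
    rw [max_eq_right (le_of_lt hs)]; simp
  -- At the kink the function is bounded by h² = o(h). Squaring thus keeps the truncation
  -- differentiable on the level set w = ε, so the chain rule needs no exceptional set there.
  · rw [max_self, mul_zero, hasDerivAt_iff_isLittleO_nhds_zero]
    simp only [zero_add, max_self, smul_zero, sub_zero]
    have h1 : (fun h : ℝ => max h 0 ^ 2 - 0 ^ 2) =O[𝓝 0] fun h => h ^ 2 := by
      refine Asymptotics.IsBigO.of_bound 1 (Eventually.of_forall fun h => ?_)
      rw [one_mul, Real.norm_eq_abs, Real.norm_eq_abs]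
      rcases le_total h 0 with hh | hh
      · rw [max_eq_right hh]; simp; positivity
      · rw [max_eq_left hh]; simp
    exact h1.trans_isLittleO (by simpa using Asymptotics.isLittleO_pow_id (𝕜 := ℝ) one_lt_two)
  · rw [max_eq_left h.le]
    have h1 : HasDerivAt (fun s : ℝ => s ^ 2) (2 * t) t := by
      simpa using hasDerivAt_pow 2 t
    refine h1.congr_of_eventuallyEq ?_
    filter_upwards [lt_mem_nhds h] with s hs
    rw [max_eq_left (le_of_lt hs)]

/-- A `C¹` function with compact support in an open set that equals one near a compact subset. -/
theorem exists_cutoff {S Ω : Set Plane} (hS : IsCompact S) (hΩ : IsOpen Ω) (h : S ⊆ Ω) :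
    ∃ (χ : Plane → ℝ) (t : Set Plane), ContDiff ℝ 1 χ ∧ IsCompact t ∧ t ⊆ Ω ∧
      (∀ x ∈ S, χ =ᶠ[𝓝 x] 1) ∧ ∀ x ∉ t, χ x = 0 := by
  obtain ⟨t, ht, hSt, htΩ⟩ := exists_compact_between hS hΩ h
  obtain ⟨f, hf1, hf0, -⟩ := exists_contMDiffMap_one_nhds_of_subset_interior
    (modelWithCornersSelf ℝ Plane) (n := 1) hS.isClosed hSt
  exact ⟨f, t, f.contMDiff.contDiff, ht, htΩ,
    fun x hx => (eventually_nhdsSet_iff_forall.1 hf1 x hx), hf0⟩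

/-- Integration by parts for a Lipschitz function with compact support in the domain. -/
theorem sum_integral_lineDeriv_mul {Ω : Set Plane} (hΩ : IsOpen Ω) {b : Plane → Plane}
    (hb1 : ContDiffOn ℝ 1 b Ω) {ψ : Plane → ℝ} {C : NNReal} (hψ : LipschitzWith C ψ)
    {S : Set Plane} (hS : IsCompact S) (hSΩ : S ⊆ Ω) (hψ0 : ∀ x ∉ S, ψ x = 0) :
    ∃ g : Fin 2 → Plane → ℝ, (∀ r x, x ∉ Ω → g r x = 0) ∧ (∀ r, ∀ x ∈ S, g r x = b x r) ∧
      (∀ r, Integrable fun x => lineDeriv ℝ ψ x (EuclideanSpace.single r 1) * g r x) ∧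
      (∑ r, ∫ x, lineDeriv ℝ ψ x (EuclideanSpace.single r 1) * g r x) = ∫ x, -(div b x * ψ x) ∧
      Integrable fun x => -(div b x * ψ x) := by
  obtain ⟨χ, t, hχ, ht, htΩ, hχ1, hχ0⟩ := exists_cutoff hS hΩ hSΩ
  -- The cutoff makes the field C¹ with compact support on the whole plane without changing it near
  -- S, where ψ lives.
  let g : Fin 2 → Plane → ℝ := fun r x => χ x * b x r
  have hgt : ∀ r x, x ∉ t → g r x = 0 := fun r x hx => by simp only [g, hχ0 x hx, zero_mul]
  have hbr : ∀ r, ContDiffOn ℝ 1 (fun x => b x r) Ω := fun r =>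
    (EuclideanSpace.proj (𝕜 := ℝ) r).contDiff.comp_contDiffOn hb1
  have hg : ∀ r, ContDiff ℝ 1 (g r) := by
    intro r
    rw [contDiff_iff_contDiffAt]
    intro x
    by_cases hx : x ∈ Ω
    · exact hχ.contDiffAt.mul ((hbr r).contDiffAt (hΩ.mem_nhds hx))
    · refine (contDiffAt_const (c := (0 : ℝ))).congr_of_eventuallyEq ?_
      filter_upwards [ht.isClosed.isOpen_compl.mem_nhds fun h => hx (htΩ h)] with y hy
        using hgt r y hy
  have hgc : ∀ r, HasCompactSupport (g r) := fun r => HasCompactSupport.intro ht (hgt r)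
  have hgS : ∀ r, ∀ x ∈ S, g r =ᶠ[𝓝 x] fun y => b y r := by
    intro r x hx
    filter_upwards [hχ1 x hx] with y hy
    simp only [g, hy, Pi.one_apply, one_mul]
  have hderiv : ∀ r, ∀ x ∈ S, lineDeriv ℝ (g r) x (-EuclideanSpace.single r 1)
      = -(fderiv ℝ b x (EuclideanSpace.single r 1)) r := by
    intro r x hx
    have hbd : HasFDerivAt b (fderiv ℝ b x) x :=
      ((hb1.contDiffAt (hΩ.mem_nhds (hSΩ hx))).differentiableAt one_ne_zero).hasFDerivAt
    have h1 : HasFDerivAt (fun y => b y r)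
        ((EuclideanSpace.proj (𝕜 := ℝ) r : Plane →L[ℝ] ℝ).comp (fderiv ℝ b x)) x :=
      (EuclideanSpace.proj (𝕜 := ℝ) r : Plane →L[ℝ] ℝ).hasFDerivAt.comp x hbd
    have h2 := ((h1.congr_of_eventuallyEq (hgS r x hx)).hasLineDerivAt
      (-EuclideanSpace.single r 1)).lineDeriv
    rw [h2]
    simp
  have hpt : ∀ x, ∑ r, lineDeriv ℝ (g r) x (-EuclideanSpace.single r 1) * ψ x
      = -(div b x * ψ x) := by
    intro x
    by_cases hx : x ∈ S
    · rw [Finset.sum_congr rfl fun r _ => by rw [hderiv r x hx], div, Finset.sum_mul,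
        ← Finset.sum_neg_distrib]
      exact Finset.sum_congr rfl fun r _ => by ring
    · simp [hψ0 x hx]
  have hint : ∀ r, Integrable
      fun x => lineDeriv ℝ (g r) x (-EuclideanSpace.single r 1) * ψ x := by
    intro r
    have hcont : Continuous fun x => lineDeriv ℝ (g r) x (-EuclideanSpace.single r 1) := by
      have h1 : (fun x => lineDeriv ℝ (g r) x (-EuclideanSpace.single r 1))
          = fun x => fderiv ℝ (g r) x (-EuclideanSpace.single r 1) := by
        funext x
        exact (((hg r).differentiable one_ne_zero) x).lineDeriv_eq_fderiv
      rw [h1]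
      exact ((hg r).continuous_fderiv one_ne_zero).clm_apply continuous_const
    refine (hcont.mul hψ.continuous).integrable_of_hasCompactSupport ?_
    exact HasCompactSupport.intro hS fun x hx => by simp only [Pi.mul_apply, hψ0 x hx, mul_zero]
  refine ⟨g, fun r x hx => hgt r x fun h => hx (htΩ h),
    fun r x hx => (hgS r x hx).eq_of_nhds, fun r => ?_, ?_, ?_⟩
  · exact ((hg r).continuous.integrable_of_hasCompactSupport (hgc r)).mul_of_top_right
      (hψ.memLp_lineDeriv _)
  · simp_rw [← hpt]
    rw [integral_finsetSum _ fun r _ => hint r]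
    refine Finset.sum_congr rfl fun r _ => ?_
    obtain ⟨D, hD⟩ := (hg r).lipschitzWith_of_hasCompactSupport (hgc r) one_ne_zero
    exact hψ.integral_lineDeriv_mul_eq hD (hgc r) _
  · simp_rw [← hpt]
    exact integrable_finsetSum _ fun r _ => hint r

namespace Triangulation

variable {Ω : Set Plane} {T : Triangulation Ω} {w : Plane → ℝ}

/-- A difference of squares is the difference of the truncations, at most L‖x - y‖, times their sum,
at most 2|M|. -/
theorem lipschitzWith_max_sub_sq {L : ℝ} (hL : ∀ x y, |w x - w y| ≤ L * ‖x - y‖) {M : ℝ}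
    (hM : ∀ x, w x ≤ M) {ε : ℝ} (hε : 0 ≤ ε) :
    ∃ C : NNReal, LipschitzWith C fun x => max (w x - ε) 0 ^ 2 := by
  refine ⟨(L * (2 * |M|)).toNNReal, LipschitzWith.of_dist_le_mul fun x y => ?_⟩
  have hb : ∀ z, |max (w z - ε) 0| ≤ |M| := by
    intro z
    rw [abs_of_nonneg (le_max_right _ _)]
    exact max_le ((by linarith [hM z] : w z - ε ≤ M).trans (le_abs_self M)) (abs_nonneg M)
  have h1 : |max (w x - ε) 0 - max (w y - ε) 0| ≤ L * ‖x - y‖ := by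
    refine (abs_max_sub_max_le_abs _ _ _).trans ?_
    rw [sub_sub_sub_cancel_right]
    exact hL x y
  have h2 : |max (w x - ε) 0 + max (w y - ε) 0| ≤ 2 * |M| := by
    refine (abs_add_le _ _).trans ?_
    linarith [hb x, hb y]
  rw [Real.dist_eq, dist_eq_norm]
  have h3 : max (w x - ε) 0 ^ 2 - max (w y - ε) 0 ^ 2
      = (max (w x - ε) 0 - max (w y - ε) 0) * (max (w x - ε) 0 + max (w y - ε) 0) := by ring
  rw [h3, abs_mul]
  refine (mul_le_mul h1 h2 (abs_nonneg _) ((abs_nonneg _).trans h1)).trans ?_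
  have h4 : L * ‖x - y‖ * (2 * |M|) = L * (2 * |M|) * ‖x - y‖ := by ring
  rw [h4]
  exact mul_le_mul_of_nonneg_right (Real.le_coe_toNNReal _) (norm_nonneg _)

/-- The energy estimate for the convection and reaction terms, for a truncated function. -/
theorem IsP1.convection_nonneg_truncated (hw : T.IsP1 w) (hreg : interior (closure Ω) = Ω)
    (hw0 : ∀ x ∉ Ω, w x = 0) {b : Plane → Plane} {c : Plane → ℝ}
    (hb : ContinuousOn b (closure Ω)) (hb1 : ContDiffOn ℝ 1 b Ω) (hc : ContinuousOn c (closure Ω))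
    (hbc : ∀ x ∈ Ω, 0 ≤ c x - (1 / 2) * div b x) {ε : ℝ} (hε : 0 < ε) :
    0 ≤ (∑ K ∈ T.elems, ∫ x in convexHull ℝ (K : Set Plane),
          max (w x - ε) 0 * inner ℝ (b x) (elemGrad K w))
      + ∑ K ∈ T.elems, ∫ x in convexHull ℝ (K : Set Plane), c x * max (w x - ε) 0 ^ 2 := by
  have hΩ : IsOpen Ω := hreg ▸ isOpen_interior
  have hL := hw.abs_sub_le hreg hw0
  have hwc : Continuous w := by
    refine (LipschitzWith.of_dist_le_mul
      (K := (∑ K ∈ T.elems, ‖elemGrad K w‖).toNNReal) fun x y => ?_).continuous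
    rw [Real.dist_eq, dist_eq_norm]
    exact (hL x y).trans (mul_le_mul_of_nonneg_right (Real.le_coe_toNNReal _) (norm_nonneg _))
  obtain ⟨M, hM⟩ : ∃ M, ∀ x, w x ≤ M := by
    obtain ⟨M, hM⟩ := (T.isCompact_closure.image hwc).bddAbove
    refine ⟨max M 0, fun x => ?_⟩
    by_cases hx : x ∈ closure Ω
    · exact (hM (mem_image_of_mem w hx)).trans (le_max_left _ _)
    · rw [hw0 x fun h => hx (_root_.subset_closure h)]; exact le_max_right _ _
  obtain ⟨C, hC⟩ := lipschitzWith_max_sub_sq hL hM hε.le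
  set ψ : Plane → ℝ := fun x => max (w x - ε) 0 ^ 2 with hψ
  set S : Set Plane := {x | ε ≤ w x} with hSdef
  have hSΩ : S ⊆ Ω := by
    intro x hx
    by_contra h
    have h1 : ε ≤ w x := hx
    rw [hw0 x h] at h1
    exact absurd h1 (not_le.2 hε)
  have hScl : IsClosed S := isClosed_le continuous_const hwc
  have hS : IsCompact S :=
    T.isCompact_closure.of_isClosed_subset hScl (hSΩ.trans _root_.subset_closure)
  have hm0 : ∀ x ∉ S, max (w x - ε) 0 = 0 := by
    intro x hx
    have : w x < ε := not_le.1 hx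
    exact max_eq_right (by linarith)
  have hψ0 : ∀ x ∉ S, ψ x = 0 := fun x hx => by simp only [hψ, hm0 x hx]; norm_num
  obtain ⟨g, hg0, hgS, hgint, heq, hdint⟩ := sum_integral_lineDeriv_mul hΩ hb1 hC hS hSΩ hψ0
  have hout : ∀ x ∉ closure Ω, x ∉ Ω := fun x hx h => hx (_root_.subset_closure h)
  have hl1 : ∀ r, ∫ x, lineDeriv ℝ ψ x (EuclideanSpace.single r 1) * g r x
      = ∑ K ∈ T.elems, ∫ x in convexHull ℝ (K : Set Plane),
          2 * max (w x - ε) 0 * elemGrad K w r * b x r := by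
    intro r
    rw [← setIntegral_eq_integral_of_forall_compl_eq_zero (s := closure Ω) fun x hx => by
        rw [hg0 r x (hout x hx), mul_zero], T.integral_closure (hgint r).integrableOn]
    refine Finset.sum_congr rfl fun K hK => integral_congr_ae ?_
    filter_upwards [IsTriangle.ae_mem_interior K] with x hx
    have h1 := (hw.hasGradientAt hK hx).hasFDerivAt
    have h2' := (hasDerivAt_max_zero_sq (w x - ε)).comp_hasFDerivAt x (h1.sub_const ε)
    have h2 : HasFDerivAt ψ ((2 * max (w x - ε) 0) •
        (InnerProductSpace.toDual ℝ Plane) (elemGrad K w)) x := h2'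
    have h3 : lineDeriv ℝ ψ x (EuclideanSpace.single r 1)
        = 2 * max (w x - ε) 0 * elemGrad K w r := by
      rw [(h2.hasLineDerivAt (EuclideanSpace.single r 1)).lineDeriv]
      simp [EuclideanSpace.inner_single_right]
    rw [h3]
    -- Off S the field g may differ from b, but there the truncation and with it the gradient of ψ
    -- vanish.
    by_cases hxS : x ∈ S
    · rw [hgS r x hxS]
    · rw [hm0 x hxS]; simp
  have hl2 : ∑ r, ∫ x, lineDeriv ℝ ψ x (EuclideanSpace.single r 1) * g r x
      = 2 * ∑ K ∈ T.elems, ∫ x in convexHull ℝ (K : Set Plane),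
          max (w x - ε) 0 * inner ℝ (b x) (elemGrad K w) := by
    rw [Finset.sum_congr rfl fun r _ => hl1 r, Finset.sum_comm, Finset.mul_sum]
    refine Finset.sum_congr rfl fun K hK => ?_
    have hbr : ∀ r : Fin 2, ContinuousOn (fun x => b x r) (closure Ω) := fun r =>
      (EuclideanSpace.proj (𝕜 := ℝ) r).continuous.comp_continuousOn hb
    rw [← integral_finsetSum _ fun r _ => ?_, ← integral_const_mul]
    · refine integral_congr_ae (Eventually.of_forall fun x => ?_)
      simp only [PiLp.inner_apply, Fin.sum_univ_two, RCLike.inner_apply, conj_trivial]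
      ring
    · refine T.integrableOn_elem ?_ hK
      have := hbr r
      fun_prop
  -- Here -div b ≥ -2c on Ω enters, multiplied by ψ ≥ 0.
  have hr : -(2 * ∑ K ∈ T.elems, ∫ x in convexHull ℝ (K : Set Plane), c x * max (w x - ε) 0 ^ 2)
      ≤ ∫ x, -(div b x * ψ x) := by
    have hcont : ContinuousOn (fun x => c x * max (w x - ε) 0 ^ 2) (closure Ω) := by
      have : Continuous fun x => max (w x - ε) 0 ^ 2 := by fun_prop
      exact hc.mul this.continuousOn
    have hint : IntegrableOn (fun x => c x * max (w x - ε) 0 ^ 2) (closure Ω) :=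
      hcont.integrableOn_compact T.isCompact_closure
    have hR : ∫ x, -(div b x * ψ x) = ∫ x in closure Ω, -(div b x * ψ x) :=
      (setIntegral_eq_integral_of_forall_compl_eq_zero fun x hx => by
        rw [hψ0 x fun h => hout x hx (hSΩ h), mul_zero, neg_zero]).symm
    rw [hR, ← T.integral_closure hint, ← integral_const_mul, ← integral_neg]
    refine setIntegral_mono_on (hint.const_mul 2).neg hdint.integrableOn
      isClosed_closure.measurableSet fun x _ => ?_
    by_cases hx : x ∈ S
    · have h1 := hbc x (hSΩ hx)
      have h2 : 0 ≤ ψ x := sq_nonneg _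
      have h3 := mul_nonneg h1 h2
      simp only [hψ] at h3 ⊢
      nlinarith
    · simp only [hψ, hm0 x hx]; norm_num
  rw [← heq, hl2] at hr
  linarith

/-- The convection and reaction terms of the bilinear form are nonnegative on the diagonal. -/
theorem IsP1.convection_nonneg (hw : T.IsP1 w) (hreg : interior (closure Ω) = Ω)
    (hw0 : ∀ x ∉ Ω, w x = 0) (hwnn : ∀ x, 0 ≤ w x) {b : Plane → Plane} {c : Plane → ℝ}
    (hb : ContinuousOn b (closure Ω)) (hb1 : ContDiffOn ℝ 1 b Ω) (hc : ContinuousOn c (closure Ω))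
    (hbc : ∀ x ∈ Ω, 0 ≤ c x - (1 / 2) * div b x) :
    0 ≤ (∑ K ∈ T.elems, ∫ x in convexHull ℝ (K : Set Plane), w x * inner ℝ (b x) (elemGrad K w))
      + ∑ K ∈ T.elems, ∫ x in convexHull ℝ (K : Set Plane), c x * w x * w x := by
  have hlim : ∀ x, Tendsto (fun ε : ℝ => max (w x - ε) 0) (𝓝[>] 0) (𝓝 (w x)) := by
    intro x
    have h1 : Continuous fun ε : ℝ => max (w x - ε) 0 := by fun_prop
    have h2 := h1.tendsto 0
    rw [sub_zero, max_eq_left (hwnn x)] at h2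
    exact h2.mono_left nhdsWithin_le_nhds
  have hpos : ∀ᶠ ε : ℝ in 𝓝[>] 0, 0 < ε := eventually_mem_nhdsWithin
  have hle : ∀ ε : ℝ, 0 < ε → ∀ x, |max (w x - ε) 0| ≤ w x := by
    intro ε hε x
    rw [abs_of_nonneg (le_max_right _ _)]
    exact max_le (by linarith) (hwnn x)
  have hmcont : ∀ ε : ℝ, ContinuousOn (fun x => max (w x - ε) 0) (closure Ω) := fun ε =>
    (by fun_prop : Continuous fun t : ℝ => max (t - ε) 0).comp_continuousOn hw.1
  -- As ε ↓ 0 the truncations converge pointwise to w ≥ 0 and are dominated by w; no derivative of b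
  -- appears in these integrals any more.
  refine ge_of_tendsto (f := fun ε : ℝ =>
    (∑ K ∈ T.elems, ∫ x in convexHull ℝ (K : Set Plane),
          max (w x - ε) 0 * inner ℝ (b x) (elemGrad K w))
      + ∑ K ∈ T.elems, ∫ x in convexHull ℝ (K : Set Plane), c x * max (w x - ε) 0 ^ 2)
    (x := 𝓝[>] 0) (Tendsto.add ?_ ?_) ?_
  · refine tendsto_finsetSum _ fun K hK => ?_
    have hbg : ContinuousOn (fun x => inner ℝ (b x) (elemGrad K w)) (closure Ω) :=
      hb.inner continuousOn_const
    refine tendsto_integral_filter_of_dominated_convergence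
      (fun x => ‖w x * inner ℝ (b x) (elemGrad K w)‖) ?_ ?_ ?_ ?_
    · exact Eventually.of_forall fun ε =>
        (T.integrableOn_elem ((hmcont ε).mul hbg) hK).aestronglyMeasurable
    · filter_upwards [hpos] with ε hε
      refine Eventually.of_forall fun x => ?_
      rw [norm_mul, norm_mul, Real.norm_eq_abs, Real.norm_eq_abs (w x), abs_of_nonneg (hwnn x)]
      exact mul_le_mul_of_nonneg_right (hle ε hε x) (norm_nonneg _)
    · exact (T.integrableOn_elem (hw.1.mul hbg) hK).norm
    · exact Eventually.of_forall fun x => (hlim x).mul_const _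
  · refine tendsto_finsetSum _ fun K hK => ?_
    refine tendsto_integral_filter_of_dominated_convergence
      (fun x => ‖c x * w x * w x‖) ?_ ?_ ?_ ?_
    · exact Eventually.of_forall fun ε =>
        (T.integrableOn_elem (hc.mul ((hmcont ε).pow 2)) hK).aestronglyMeasurable
    · filter_upwards [hpos] with ε hε
      refine Eventually.of_forall fun x => ?_
      rw [mul_assoc, norm_mul, norm_mul (c x), ← pow_two, norm_pow, norm_pow, Real.norm_eq_abs,
        Real.norm_eq_abs, Real.norm_eq_abs (w x), abs_of_nonneg (hwnn x)]
      exact mul_le_mul_of_nonneg_left (pow_le_pow_left₀ (abs_nonneg _) (hle ε hε x) 2)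
        (abs_nonneg _)
    · exact (T.integrableOn_elem ((hc.mul hw.1).mul hw.1) hK).norm
    · refine Eventually.of_forall fun x => ?_
      rw [mul_assoc, ← pow_two]
      exact ((hlim x).pow 2).const_mul _
  · filter_upwards [hpos] with ε hε
    exact hw.convection_nonneg_truncated hreg hw0 hb hb1 hc hbc hε

/-- Coercivity of the bilinear form on nonnegative functions that vanish on the boundary. -/
theorem IsP1.eq_zero_of_sum_elemForm_nonpos (hw : T.IsP1 w) (hreg : interior (closure Ω) = Ω)
    (hw0 : ∀ x ∉ Ω, w x = 0) (hwnn : ∀ x, 0 ≤ w x) {D : Plane → Matrix (Fin 2) (Fin 2) ℝ}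
    {b : Plane → Plane} {c : Plane → ℝ} (hD : ContinuousOn D (closure Ω))
    (hDpos : ∀ x ∈ Ω, (D x).PosDef) (hb : ContinuousOn b (closure Ω)) (hb1 : ContDiffOn ℝ 1 b Ω)
    (hc : ContinuousOn c (closure Ω)) (hbc : ∀ x ∈ Ω, 0 ≤ c x - (1 / 2) * div b x)
    (h : ∑ K ∈ T.elems, elemForm D b c K w w ≤ 0) (x : Plane) : w x = 0 := by
  refine hw.eq_zero_of_elemGrad hreg hw0 (fun K hK => ?_) x
  -- One nonzero element gradient would make the diffusion sum strictly positive, while the other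
  -- terms are nonnegative in total.
  by_contra hne
  have h1 := hw.convection_nonneg hreg hw0 hwnn hb hb1 hc hbc
  simp only [elemForm, Finset.sum_add_distrib] at h
  have hpos : ∀ L ∈ T.elems, elemGrad L w ≠ 0 → 0 < area (convexHull ℝ (L : Set Plane)) *
      form (avg D (convexHull ℝ (L : Set Plane))) (elemGrad L w) (elemGrad L w) := fun L hL hg =>
    mul_pos (T.isTriangle hL).area_pos (form_pos_of_posDef (T.posDef_avg hreg hD hDpos hL) hg)
  have hnn : ∀ L ∈ T.elems, 0 ≤ area (convexHull ℝ (L : Set Plane)) *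
      form (avg D (convexHull ℝ (L : Set Plane))) (elemGrad L w) (elemGrad L w) := by
    intro L hL
    by_cases hg : elemGrad L w = 0
    · rw [hg, form_eq]; simp
    · exact (hpos L hL hg).le
  have h2 := Finset.single_le_sum hnn hK
  linarith [hpos K hK hne]

end Triangulation

/-! ### The bilinear form and the load on the finite element space -/

theorem affGrad_add (l l' : Plane →ᵃ[ℝ] ℝ) : affGrad (l + l') = affGrad l + affGrad l' := by
  simp [affGrad]

theorem affGrad_smul (t : ℝ) (l : Plane →ᵃ[ℝ] ℝ) : affGrad (t • l) = t • affGrad l := by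
  simp [affGrad]

namespace Triangulation

variable {Ω : Set Plane} {T : Triangulation Ω}

/-- The space of linear finite element functions. -/
def p1Space (T : Triangulation Ω) : Submodule ℝ (Plane → ℝ) where
  carrier := {u | T.IsP1 u}
  add_mem' := fun {u v} hu hv => T.isP1_of_forall_elem fun K hK => by
    obtain ⟨l, hl⟩ := hu.2 K hK
    obtain ⟨l', hl'⟩ := hv.2 K hK
    exact ⟨l + l', fun x hx => by simp [hl hx, hl' hx]⟩
  zero_mem' := T.isP1_of_forall_elem fun _ _ => ⟨0, fun _ _ => rfl⟩
  smul_mem' := fun t u hu => T.isP1_of_forall_elem fun K hK => by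
    obtain ⟨l, hl⟩ := hu.2 K hK
    exact ⟨t • l, fun x hx => by simp [hl hx]⟩

/-- The nodal basis functions as elements of the finite element space. -/
noncomputable def nodal (T : Triangulation Ω) (a : Plane) : T.p1Space := ⟨T.hat a, T.isP1_hat a⟩

theorem coe_sum_smul_nodal (s : Finset Plane) (z : Plane → ℝ) (x : Plane) :
    ((∑ a ∈ s, z a • T.nodal a : T.p1Space) : Plane → ℝ) x = ∑ a ∈ s, z a * T.hat a x := by
  simp [nodal, Finset.sum_apply]

theorem elemGrad_add {K : Finset Plane} (hK : K ∈ T.elems) (u v : T.p1Space) :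
    elemGrad K ((u : Plane → ℝ) + v) = elemGrad K u + elemGrad K v := by
  obtain ⟨l, hl⟩ := u.2.2 K hK
  obtain ⟨l', hl'⟩ := v.2.2 K hK
  rw [(T.isTriangle hK).elemGrad_eq hl, (T.isTriangle hK).elemGrad_eq hl', ← affGrad_add]
  exact (T.isTriangle hK).elemGrad_eq fun x hx => by simp [hl hx, hl' hx]

theorem elemGrad_smul {K : Finset Plane} (hK : K ∈ T.elems) (t : ℝ) (u : T.p1Space) :
    elemGrad K (t • (u : Plane → ℝ)) = t • elemGrad K u := by
  obtain ⟨l, hl⟩ := u.2.2 K hK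
  rw [(T.isTriangle hK).elemGrad_eq hl, ← affGrad_smul]
  exact (T.isTriangle hK).elemGrad_eq fun x hx => by simp [hl hx]

theorem elemGrad_congr {K : Finset Plane} (hK : K ∈ T.elems) {u v : Plane → ℝ} (hu : T.IsP1 u)
    (h : EqOn v u (convexHull ℝ (K : Set Plane))) : elemGrad K v = elemGrad K u := by
  obtain ⟨l, hl⟩ := hu.2 K hK
  rw [(T.isTriangle hK).elemGrad_eq hl, (T.isTriangle hK).elemGrad_eq (h.trans hl)]

variable {D : Plane → Matrix (Fin 2) (Fin 2) ℝ} {b : Plane → Plane} {c : Plane → ℝ}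

/-- Members of `p1Space` are arbitrary off the closure of Ω, so that space is infinite-dimensional
and nodal expansions hold only on the closure. This lemma lets them be substituted into the form. -/
theorem elemForm_congr {K : Finset Plane} (hK : K ∈ T.elems) {u u' v v' : Plane → ℝ}
    (hu : T.IsP1 u) (hv : T.IsP1 v) (h : EqOn u' u (closure Ω)) (h' : EqOn v' v (closure Ω)) :
    elemForm D b c K u' v' = elemForm D b c K u v := by
  have hsub := T.subset_closure hK
  have hmeas := (IsTriangle.isCompact_convexHull K).isClosed.measurableSet
  rw [elemForm, elemForm, elemGrad_congr hK hu (h.mono hsub), elemGrad_congr hK hv (h'.mono hsub)]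
  congr 1
  · congr 1
    exact setIntegral_congr_fun hmeas fun x hx => by simp only [h' (hsub hx)]
  · exact setIntegral_congr_fun hmeas fun x hx => by simp only [h' (hsub hx), h (hsub hx)]

/-- The bilinear form of the scheme. -/
theorem exists_bilinear (T : Triangulation Ω) (D : Plane → Matrix (Fin 2) (Fin 2) ℝ)
    (hb : ContinuousOn b (closure Ω)) (hc : ContinuousOn c (closure Ω)) :
    ∃ B : T.p1Space →ₗ[ℝ] T.p1Space →ₗ[ℝ] ℝ,
      ∀ u v, B u v = ∑ K ∈ T.elems, elemForm D b c K u v := by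
  have hinner : ∀ y : Plane, ContinuousOn (fun x => inner ℝ (b x) y) (closure Ω) := fun y =>
    hb.inner continuousOn_const
  have hi1 : ∀ K ∈ T.elems, ∀ (v : T.p1Space) (y : Plane), IntegrableOn
      (fun x => (v : Plane → ℝ) x * inner ℝ (b x) y) (convexHull ℝ (K : Set Plane)) :=
    fun K hK v y => T.integrableOn_elem (v.2.1.mul (hinner y)) hK
  have hi2 : ∀ K ∈ T.elems, ∀ u v : T.p1Space, IntegrableOn
      (fun x => c x * (u : Plane → ℝ) x * (v : Plane → ℝ) x) (convexHull ℝ (K : Set Plane)) :=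
    fun K hK u v => T.integrableOn_elem ((hc.mul u.2.1).mul v.2.1) hK
  refine ⟨LinearMap.mk₂ ℝ (fun u v => ∑ K ∈ T.elems, elemForm D b c K u v) ?_ ?_ ?_ ?_,
    fun u v => rfl⟩
  · intro u u' v
    rw [← Finset.sum_add_distrib]
    refine Finset.sum_congr rfl fun K hK => ?_
    simp only [elemForm, Submodule.coe_add, elemGrad_add hK, inner_add_right, Pi.add_apply,
      mul_add, add_mul]
    rw [integral_add (hi1 K hK _ _) (hi1 K hK _ _), integral_add (hi2 K hK _ _) (hi2 K hK _ _)]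
    simp only [form_eq, PiLp.add_apply]
    ring
  · intro t u v
    rw [smul_eq_mul, Finset.mul_sum]
    refine Finset.sum_congr rfl fun K hK => ?_
    simp only [elemForm, Submodule.coe_smul, elemGrad_smul hK, inner_smul_right, Pi.smul_apply,
      smul_eq_mul]
    have h1 : ∀ x, (v : Plane → ℝ) x * (t * inner ℝ (b x) (elemGrad K u))
        = t * ((v : Plane → ℝ) x * inner ℝ (b x) (elemGrad K u)) := fun x => by ring
    have h2 : ∀ x, c x * (t * (u : Plane → ℝ) x) * (v : Plane → ℝ) x
        = t * (c x * (u : Plane → ℝ) x * (v : Plane → ℝ) x) := fun x => by ring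
    simp_rw [h1, h2]
    rw [integral_const_mul, integral_const_mul]
    simp only [form_eq, PiLp.smul_apply, smul_eq_mul]
    ring
  · intro u v v'
    rw [← Finset.sum_add_distrib]
    refine Finset.sum_congr rfl fun K hK => ?_
    simp only [elemForm, Submodule.coe_add, elemGrad_add hK, Pi.add_apply, mul_add, add_mul]
    rw [integral_add (hi1 K hK _ _) (hi1 K hK _ _), integral_add (hi2 K hK _ _) (hi2 K hK _ _)]
    simp only [form_eq, PiLp.add_apply]
    ring
  · intro t u v
    rw [smul_eq_mul, Finset.mul_sum]
    refine Finset.sum_congr rfl fun K hK => ?_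
    simp only [elemForm, Submodule.coe_smul, elemGrad_smul hK, Pi.smul_apply, smul_eq_mul]
    have h1 : ∀ x, t * (v : Plane → ℝ) x * inner ℝ (b x) (elemGrad K u)
        = t * ((v : Plane → ℝ) x * inner ℝ (b x) (elemGrad K u)) := fun x => by ring
    have h2 : ∀ x, c x * (u : Plane → ℝ) x * (t * (v : Plane → ℝ) x)
        = t * (c x * (u : Plane → ℝ) x * (v : Plane → ℝ) x) := fun x => by ring
    simp_rw [h1, h2]
    rw [integral_const_mul, integral_const_mul]
    simp only [form_eq, PiLp.smul_apply, smul_eq_mul]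
    ring

/-- The load functional of the scheme. -/
theorem exists_load (T : Triangulation Ω) {f : Plane → ℝ} (hf : ContinuousOn f (closure Ω)) :
    ∃ F : T.p1Space →ₗ[ℝ] ℝ, ∀ v, F v = ∑ K ∈ T.elems,
      ∫ x in convexHull ℝ (K : Set Plane), f x * (v : Plane → ℝ) x := by
  have hi : ∀ K ∈ T.elems, ∀ v : T.p1Space, IntegrableOn
      (fun x => f x * (v : Plane → ℝ) x) (convexHull ℝ (K : Set Plane)) :=
    fun K hK v => T.integrableOn_elem (hf.mul v.2.1) hK
  refine ⟨⟨⟨fun v => ∑ K ∈ T.elems, ∫ x in convexHull ℝ (K : Set Plane),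
    f x * (v : Plane → ℝ) x, fun u v => ?_⟩, fun t u => ?_⟩, fun v => rfl⟩
  · rw [← Finset.sum_add_distrib]
    refine Finset.sum_congr rfl fun K hK => ?_
    rw [← integral_add (hi K hK _) (hi K hK _)]
    simp only [Submodule.coe_add, Pi.add_apply, mul_add]
  · simp only [RingHom.id_apply, smul_eq_mul]
    rw [Finset.mul_sum]
    refine Finset.sum_congr rfl fun K hK => ?_
    rw [← integral_const_mul]
    simp only [Submodule.coe_smul, Pi.smul_apply, smul_eq_mul, mul_left_comm]

/-! ### The discrete maximum principle and unique solvability -/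

theorem mem_frontier_iff (hreg : interior (closure Ω) = Ω) {a : Plane} (ha : a ∈ T.vertices) :
    a ∈ frontier Ω ↔ a ∉ Ω := by
  have hΩ : IsOpen Ω := hreg ▸ isOpen_interior
  rw [hΩ.frontier_eq]
  exact ⟨fun h => h.2, fun h => ⟨T.vertex_mem_closure ha, h⟩⟩

theorem sum_elemForm_one {w : Plane → ℝ} (T : Triangulation Ω) :
    ∑ K ∈ T.elems, elemForm D b c K (fun _ => 1) w
      = ∑ K ∈ T.elems, ∫ x in convexHull ℝ (K : Set Plane), c x * w x := by
  refine Finset.sum_congr rfl fun K hK => ?_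
  have hg : elemGrad K (fun _ => (1 : ℝ)) = 0 := by
    have h := (T.isTriangle hK).elemGrad_eq (u := fun _ => (1 : ℝ))
      (l := AffineMap.const ℝ Plane (1 : ℝ)) fun _ _ => rfl
    rw [h]
    simp [affGrad]
  simp [elemForm, hg, form_eq]

/-- The discrete maximum principle for subsolutions. -/
theorem IsP1.le_of_subsolution (hreg : interior (closure Ω) = Ω)
    (hD : ContinuousOn D (closure Ω)) (hb : ContinuousOn b (closure Ω)) (hb1 : ContDiffOn ℝ 1 b Ω)
    (hc : ContinuousOn c (closure Ω)) (hDpos : ∀ x ∈ Ω, (D x).PosDef)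
    (hbc : ∀ x ∈ Ω, 0 ≤ c x - (1 / 2) * div b x) (hc0 : ∀ x ∈ Ω, 0 ≤ c x)
    (hedge : ∀ i j k k' : Plane, T.InternalEdge i j k k' → EdgeCondition D b c i j k k')
    {u : Plane → ℝ} (hu : T.IsP1 u)
    (hsub : ∀ v, T.IsP1 v → (∀ a ∈ T.vertices, a ∈ frontier Ω → v a = 0) → (∀ x, 0 ≤ v x) →
      ∑ K ∈ T.elems, elemForm D b c K u v ≤ 0)
    {M : ℝ} (hM : 0 ≤ M) (hbdry : ∀ a ∈ T.vertices, a ∈ frontier Ω → u a ≤ M)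
    {x : Plane} (hx : x ∈ closure Ω) : u x ≤ M := by
  obtain ⟨B, hB⟩ := T.exists_bilinear D hb hc
  have hc0' : ∀ y ∈ closure Ω, 0 ≤ c y := fun y hy =>
    le_on_closure hc0 continuousOn_const hc hy
  -- Nodal positive and negative parts of u - M. They have disjoint vertex supports, and p vanishes
  -- at boundary vertices, so its interpolant W is an admissible test function.
  set p : Plane → ℝ := fun a => max (u a - M) 0 with hp
  set n : Plane → ℝ := fun a => max (M - u a) 0 with hn
  have hp0 : ∀ a, 0 ≤ p a := fun a => le_max_right _ _
  have hn0 : ∀ a, 0 ≤ n a := fun a => le_max_right _ _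
  have hpn : ∀ a, u a = M + p a - n a := by
    intro a
    simp only [hp, hn]
    rcases le_total (u a) M with h | h
    · rw [max_eq_right (by linarith), max_eq_left (by linarith)]; ring
    · rw [max_eq_left (by linarith), max_eq_right (by linarith)]; ring
  have hpn0 : ∀ a, n a * p a = 0 := by
    intro a
    simp only [hp, hn]
    rcases le_total (u a) M with h | h
    · rw [max_eq_right (by linarith : u a - M ≤ 0), mul_zero]
    · rw [max_eq_right (by linarith : M - u a ≤ 0), zero_mul]
  have hpb : ∀ a ∈ T.vertices, a ∉ Ω → p a = 0 := fun a ha haΩ =>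
    max_eq_right (by linarith [hbdry a ha ((mem_frontier_iff hreg ha).2 haΩ)])
  set W : T.p1Space := ∑ a ∈ T.vertexFinset, p a • T.nodal a with hW
  set N : T.p1Space := ∑ a ∈ T.vertexFinset, n a • T.nodal a with hN
  have hWx : ∀ y, (W : Plane → ℝ) y = ∑ a ∈ T.vertexFinset, p a * T.hat a y :=
    coe_sum_smul_nodal _ _
  have hWnn : ∀ y, 0 ≤ (W : Plane → ℝ) y := fun y => by
    rw [hWx]
    exact Finset.sum_nonneg fun a _ => mul_nonneg (hp0 a) (T.hat_nonneg a y)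
  have hW0 : ∀ y ∉ Ω, (W : Plane → ℝ) y = 0 := by
    intro y hy
    rw [hWx]
    refine Finset.sum_eq_zero fun a ha => ?_
    by_cases haΩ : a ∈ Ω
    · rw [T.hat_of_notMem hreg haΩ hy, mul_zero]
    · rw [hpb a (T.mem_vertexFinset.1 ha) haΩ, zero_mul]
  have hone : ∑ K ∈ T.elems, elemForm D b c K (fun _ => 1) (W : Plane → ℝ) ≥ 0 := by
    rw [T.sum_elemForm_one]
    refine Finset.sum_nonneg fun K hK => ?_
    exact setIntegral_nonneg (IsTriangle.isCompact_convexHull K).isClosed.measurableSet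
      fun y hy => mul_nonneg (hc0' y (T.subset_closure hK hy)) (hWnn y)
  -- In the double sum over n_a p_i a(φ_a, φ_i) the diagonal drops out since n_a p_a = 0, boundary i
  -- drop out since p_i = 0, and the remaining entries are nonpositive.
  have hNW : B N W ≤ 0 := by
    rw [hN, LinearMap.map_sum₂]
    refine Finset.sum_nonpos fun a _ => ?_
    rw [hW, map_sum]
    refine Finset.sum_nonpos fun i hi => ?_
    rw [map_smul, map_smul, LinearMap.smul_apply, smul_eq_mul, smul_eq_mul, ← mul_assoc,
      mul_comm (p i)]
    by_cases hiΩ : i ∈ Ω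
    · by_cases hia : i = a
      · rw [hia, hpn0, zero_mul]
      · refine mul_nonpos_of_nonneg_of_nonpos (mul_nonneg (hn0 a) (hp0 i)) ?_
        rw [hB]
        exact T.sum_elemForm_hat_nonpos hreg hD hb hc hDpos hedge hiΩ hia
    · rw [hpb i (T.mem_vertexFinset.1 hi) hiΩ, mul_zero, zero_mul]
  set U : T.p1Space := M • ⟨fun _ => 1, T.isP1_one⟩ + W - N with hU
  have hUu : EqOn u U (closure Ω) := by
    intro y hy
    have h1 : (U : Plane → ℝ) y = M * 1 + (W : Plane → ℝ) y - (N : Plane → ℝ) y := rfl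
    rw [h1, hWx, hN, coe_sum_smul_nodal, hu.eq_sum hy, ← T.sum_hat hy, Finset.mul_sum,
      ← Finset.sum_add_distrib, ← Finset.sum_sub_distrib]
    refine Finset.sum_congr rfl fun a _ => ?_
    conv_lhs => rw [hpn a]
    ring
  have hUW : B U W ≤ 0 := by
    rw [hB, ← Finset.sum_congr rfl fun K hK => elemForm_congr hK U.2 W.2 hUu fun _ _ => rfl]
    refine hsub W W.2 (fun a ha haf => hW0 a ((mem_frontier_iff hreg ha).1 haf)) hWnn
  have hWW : B W W ≤ 0 := by
    rw [hU, map_sub, map_add, map_smul, LinearMap.sub_apply, LinearMap.add_apply,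
      LinearMap.smul_apply, smul_eq_mul, hB ⟨fun _ => 1, T.isP1_one⟩] at hUW
    have := mul_nonneg hM hone
    simp only at hUW
    linarith
  rw [hB] at hWW
  have hWz := IsP1.eq_zero_of_sum_elemForm_nonpos W.2 hreg hW0 hWnn hD hDpos hb hb1 hc hbc hWW
  have hux : (U : Plane → ℝ) x = M * 1 + (W : Plane → ℝ) x - (N : Plane → ℝ) x := rfl
  have hNx : 0 ≤ (N : Plane → ℝ) x := by
    rw [hN, coe_sum_smul_nodal]
    exact Finset.sum_nonneg fun a _ => mul_nonneg (hn0 a) (T.hat_nonneg a x)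
  rw [hUu hx, hux, hWz x]
  linarith

theorem isSolution_iff {f g u : Plane → ℝ} :
    IsSolution T D b c f g u ↔ T.IsP1 u ∧ (∀ a ∈ T.vertices, a ∈ frontier Ω → u a = g a) ∧
      ∀ v : Plane → ℝ, T.IsP1 v → (∀ a ∈ T.vertices, a ∈ frontier Ω → v a = 0) →
        ∑ K ∈ T.elems, elemForm D b c K u v
          = ∑ K ∈ T.elems, ∫ x in convexHull ℝ (K : Set Plane), f x * v x := by
  simp only [IsSolution, elemForm, Finset.sum_add_distrib]

/-- The frontier is compact, and it is nonempty because the plane is connected and Ω is neither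
empty nor the whole plane. -/
theorem exists_mem_frontier_forall_le (hne : Ω.Nonempty) {u : Plane → ℝ}
    (hu : ContinuousOn u (closure Ω)) (T : Triangulation Ω) :
    ∃ y ∈ frontier Ω, ∀ z ∈ frontier Ω, u z ≤ u y := by
  have hcpt : IsCompact (frontier Ω) :=
    T.isCompact_closure.of_isClosed_subset isClosed_frontier frontier_subset_closure
  have hnef : (frontier Ω).Nonempty := by
    rw [nonempty_iff_ne_empty]
    intro h
    rcases isClopen_iff.1 (isClopen_iff_frontier_eq_empty.2 h) with h | h
    · exact hne.ne_empty h
    · obtain ⟨x, hx⟩ := T.exists_notMem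
      exact hx (h ▸ mem_univ x)
  obtain ⟨y, hy, hmax⟩ := hcpt.exists_isMaxOn hnef (hu.mono frontier_subset_closure)
  exact ⟨y, hy, fun z hz => hmax hz⟩

theorem sum_elemForm_neg (hb : ContinuousOn b (closure Ω)) (hc : ContinuousOn c (closure Ω))
    {u v : Plane → ℝ} (hu : T.IsP1 u) (hv : T.IsP1 v) :
    ∑ K ∈ T.elems, elemForm D b c K (-u) v = -∑ K ∈ T.elems, elemForm D b c K u v := by
  obtain ⟨B, hB⟩ := T.exists_bilinear D hb hc
  have := LinearMap.map_neg₂ B ⟨u, hu⟩ ⟨v, hv⟩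
  rwa [hB, hB] at this

theorem satisfiesDMP (hne : Ω.Nonempty) (hreg : interior (closure Ω) = Ω)
    (hD : ContinuousOn D (closure Ω)) (hb : ContinuousOn b (closure Ω)) (hb1 : ContDiffOn ℝ 1 b Ω)
    (hc : ContinuousOn c (closure Ω)) (hDpos : ∀ x ∈ Ω, (D x).PosDef)
    (hbc : ∀ x ∈ Ω, 0 ≤ c x - (1 / 2) * div b x) (hc0 : ∀ x ∈ Ω, 0 ≤ c x)
    (hedge : ∀ i j k k' : Plane, T.InternalEdge i j k k' → EdgeCondition D b c i j k k') :
    SatisfiesDMP T D b c := by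
  intro f g u hf hsol
  obtain ⟨hu, -, heq⟩ := isSolution_iff.1 hsol
  have hmeas : ∀ K : Finset Plane, MeasurableSet (convexHull ℝ (K : Set Plane)) := fun K =>
    (IsTriangle.isCompact_convexHull K).isClosed.measurableSet
  constructor
  · intro hf0 x hx
    have hf0' : ∀ y ∈ closure Ω, f y ≤ 0 := fun y hy =>
      le_on_closure hf0 hf continuousOn_const hy
    obtain ⟨y, hy, hmax⟩ := T.exists_mem_frontier_forall_le hne hu.1
    refine ⟨y, hy, hu.le_of_subsolution hreg hD hb hb1 hc hDpos hbc hc0 hedge ?_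
      (le_max_left _ _) (fun a _ haf => (hmax a haf).trans (le_max_right _ _)) hx⟩
    intro v hv hv0 hvnn
    rw [heq v hv hv0]
    exact Finset.sum_nonpos fun K hK => setIntegral_nonpos (hmeas K) fun z hz =>
      mul_nonpos_of_nonpos_of_nonneg (hf0' z (T.subset_closure hK hz)) (hvnn z)
  · intro hf0 x hx
    have hf0' : ∀ y ∈ closure Ω, 0 ≤ f y := fun y hy =>
      le_on_closure hf0 continuousOn_const hf hy
    have hnu : T.IsP1 (-u) := T.p1Space.neg_mem (x := u) hu
    obtain ⟨y, hy, hmax⟩ := T.exists_mem_frontier_forall_le hne hnu.1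
    have h := hnu.le_of_subsolution hreg hD hb hb1 hc hDpos hbc hc0 hedge ?_
      (le_max_left 0 ((-u) y)) (fun a _ haf => (hmax a haf).trans (le_max_right _ _)) hx
    · refine ⟨y, hy, ?_⟩
      simp only [Pi.neg_apply] at h
      rcases le_max_iff.1 h with h | h
      · exact (min_le_left _ _).trans (by linarith)
      · exact (min_le_right _ _).trans (by linarith)
    · intro v hv hv0 hvnn
      rw [sum_elemForm_neg hb hc hu hv, heq v hv hv0, neg_nonpos]
      exact Finset.sum_nonneg fun K hK => setIntegral_nonneg (hmeas K) fun z hz =>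
        mul_nonneg (hf0' z (T.subset_closure hK hz)) (hvnn z)

/-- A finite element function with homogeneous boundary values that solves the homogeneous discrete
equation vanishes. -/
theorem IsP1.eq_zero_of_homogeneous (hreg : interior (closure Ω) = Ω)
    (hD : ContinuousOn D (closure Ω)) (hb : ContinuousOn b (closure Ω)) (hb1 : ContDiffOn ℝ 1 b Ω)
    (hc : ContinuousOn c (closure Ω)) (hDpos : ∀ x ∈ Ω, (D x).PosDef)
    (hbc : ∀ x ∈ Ω, 0 ≤ c x - (1 / 2) * div b x) (hc0 : ∀ x ∈ Ω, 0 ≤ c x)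
    (hedge : ∀ i j k k' : Plane, T.InternalEdge i j k k' → EdgeCondition D b c i j k k')
    {u : Plane → ℝ} (hu : T.IsP1 u) (hu0 : ∀ a ∈ T.vertices, a ∈ frontier Ω → u a = 0)
    (heq : ∀ v, T.IsP1 v → (∀ a ∈ T.vertices, a ∈ frontier Ω → v a = 0) →
      ∑ K ∈ T.elems, elemForm D b c K u v = 0) {x : Plane} (hx : x ∈ closure Ω) : u x = 0 := by
  have hnu : T.IsP1 (-u) := T.p1Space.neg_mem (x := u) hu
  have h1 := hu.le_of_subsolution hreg hD hb hb1 hc hDpos hbc hc0 hedge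
    (fun v hv hv0 _ => (heq v hv hv0).le) le_rfl (fun a ha haf => (hu0 a ha haf).le) hx
  have h2 := hnu.le_of_subsolution hreg hD hb hb1 hc hDpos hbc hc0 hedge
    (fun v hv hv0 _ => by rw [sum_elemForm_neg hb hc hu hv, heq v hv hv0, neg_zero]) le_rfl
    (fun a ha haf => by rw [Pi.neg_apply, hu0 a ha haf, neg_zero]) hx
  rw [Pi.neg_apply] at h2
  linarith

/-- With one unknown and one equation for each interior vertex the stiffness matrix is square. The
maximum principle for u and -u makes it injective, hence surjective. -/
theorem uniquelySolvable (hreg : interior (closure Ω) = Ω)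
    (hD : ContinuousOn D (closure Ω)) (hb : ContinuousOn b (closure Ω)) (hb1 : ContDiffOn ℝ 1 b Ω)
    (hc : ContinuousOn c (closure Ω)) (hDpos : ∀ x ∈ Ω, (D x).PosDef)
    (hbc : ∀ x ∈ Ω, 0 ≤ c x - (1 / 2) * div b x) (hc0 : ∀ x ∈ Ω, 0 ≤ c x)
    (hedge : ∀ i j k k' : Plane, T.InternalEdge i j k k' → EdgeCondition D b c i j k k') :
    UniquelySolvable T D b c := by
  classical
  intro f g hf
  obtain ⟨B, hB⟩ := T.exists_bilinear D hb hc
  obtain ⟨F, hF⟩ := T.exists_load hf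
  have hzero : ∀ u : T.p1Space, (∀ a ∈ T.vertices, a ∈ frontier Ω → (u : Plane → ℝ) a = 0) →
      (∀ v : T.p1Space, (∀ a ∈ T.vertices, a ∈ frontier Ω → (v : Plane → ℝ) a = 0) → B u v = 0) →
      ∀ x ∈ closure Ω, (u : Plane → ℝ) x = 0 := fun u hu0 heq x hx =>
    IsP1.eq_zero_of_homogeneous hreg hD hb hb1 hc hDpos hbc hc0 hedge u.2 hu0
      (fun v hv hv0 => by rw [← hB u ⟨v, hv⟩]; exact heq ⟨v, hv⟩ hv0) hx
  set I := T.vertexFinset.filter (· ∈ Ω) with hI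
  have hIv : ∀ i ∈ I, i ∈ T.vertices ∧ i ∈ Ω := fun i hi =>
    ⟨T.mem_vertexFinset.1 (Finset.mem_filter.1 hi).1, (Finset.mem_filter.1 hi).2⟩
  have hhat : ∀ i ∈ I, ∀ a ∈ T.vertices, a ∈ frontier Ω → T.hat i a = 0 := fun i hi a ha haf =>
    T.hat_of_notMem hreg (hIv i hi).2 ((mem_frontier_iff hreg ha).1 haf)
  have hexp : ∀ v : T.p1Space, (∀ a ∈ T.vertices, a ∈ frontier Ω → (v : Plane → ℝ) a = 0) →
      EqOn (v : Plane → ℝ) ((∑ i ∈ I, (v : Plane → ℝ) i • T.nodal i : T.p1Space) : Plane → ℝ)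
        (closure Ω) := by
    intro v hv0 x hx
    rw [coe_sum_smul_nodal, IsP1.eq_sum v.2 hx, hI]
    symm
    refine Finset.sum_subset (Finset.filter_subset _ _) fun a ha haI => ?_
    have hav := T.mem_vertexFinset.1 ha
    have haΩ : a ∉ Ω := fun h => haI (Finset.mem_filter.2 ⟨ha, h⟩)
    rw [hv0 a hav ((mem_frontier_iff hreg hav).2 haΩ), zero_mul]
  have hBexp : ∀ u v : T.p1Space, (∀ a ∈ T.vertices, a ∈ frontier Ω → (v : Plane → ℝ) a = 0) →
      B u v = ∑ i ∈ I, (v : Plane → ℝ) i * B u (T.nodal i) := by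
    intro u v hv0
    have h1 : B u v = B u (∑ i ∈ I, (v : Plane → ℝ) i • T.nodal i) := by
      rw [hB, hB]
      exact Finset.sum_congr rfl fun K hK =>
        elemForm_congr hK u.2 (Subtype.property _) (fun _ _ => rfl) (hexp v hv0)
    rw [h1, map_sum]
    simp only [map_smul, smul_eq_mul]
  have hFexp : ∀ v : T.p1Space, (∀ a ∈ T.vertices, a ∈ frontier Ω → (v : Plane → ℝ) a = 0) →
      F v = ∑ i ∈ I, (v : Plane → ℝ) i * F (T.nodal i) := by
    intro v hv0
    have h1 : F v = F (∑ i ∈ I, (v : Plane → ℝ) i • T.nodal i) := by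
      rw [hF, hF]
      refine Finset.sum_congr rfl fun K hK => setIntegral_congr_fun
        (IsTriangle.isCompact_convexHull K).isClosed.measurableSet fun x hx => ?_
      simp only [hexp v hv0 (T.subset_closure hK hx)]
    rw [h1, map_sum]
    simp only [map_smul, smul_eq_mul]
  let E : (I → ℝ) →ₗ[ℝ] T.p1Space := ∑ i : I, (LinearMap.proj i).smulRight (T.nodal i)
  have hE : ∀ z x, (E z : Plane → ℝ) x = ∑ i : I, z i * T.hat i x := by
    intro z x
    simp [E, LinearMap.sum_apply, nodal, Finset.sum_apply]
  have hE0 : ∀ z, ∀ a ∈ T.vertices, a ∈ frontier Ω → (E z : Plane → ℝ) a = 0 := by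
    intro z a ha haf
    rw [hE]
    exact Finset.sum_eq_zero fun i _ => by rw [hhat i i.2 a ha haf, mul_zero]
  have hEi : ∀ z (i : I), (E z : Plane → ℝ) i = z i := by
    intro z i
    rw [hE, Finset.sum_eq_single_of_mem i (Finset.mem_univ i), T.hat_self (hIv i i.2).1, mul_one]
    intro j _ hji
    rw [T.hat_of_ne (hIv i i.2).1 fun h => hji (Subtype.ext h), mul_zero]
  let A : (I → ℝ) →ₗ[ℝ] (I → ℝ) := LinearMap.pi fun i => (B.flip (T.nodal i)).comp E
  have hA : ∀ z i, A z i = B (E z) (T.nodal i) := fun _ _ => rfl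
  have hinj : Function.Injective A := by
    rw [injective_iff_map_eq_zero]
    intro z hz
    funext i
    have h1 := hzero (E z) (hE0 z) (fun v hv0 => by
      rw [hBexp _ v hv0]
      refine Finset.sum_eq_zero fun j hj => ?_
      rw [← hA z ⟨j, hj⟩, hz, Pi.zero_apply, mul_zero]) i
      (T.vertex_mem_closure (hIv i i.2).1)
    rw [hEi] at h1
    exact h1
  -- A lift of the boundary data that vanishes at the interior vertices; the solution is G plus a
  -- combination of interior nodal functions.
  let G : T.p1Space := ∑ a ∈ T.vertexFinset.filter (· ∉ Ω), g a • T.nodal a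
  have hG : ∀ a ∈ T.vertices, a ∈ frontier Ω → (G : Plane → ℝ) a = g a := by
    intro a ha haf
    have hmem : a ∈ T.vertexFinset.filter (· ∉ Ω) :=
      Finset.mem_filter.2 ⟨T.mem_vertexFinset.2 ha, (mem_frontier_iff hreg ha).1 haf⟩
    rw [coe_sum_smul_nodal, Finset.sum_eq_single_of_mem a hmem, T.hat_self ha, mul_one]
    intro j _ hja
    rw [T.hat_of_ne ha hja, mul_zero]
  obtain ⟨z, hz⟩ := LinearMap.injective_iff_surjective.1 hinj
    fun i : I => F (T.nodal i) - B G (T.nodal i)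
  have hsol : IsSolution T D b c f g (G + E z : T.p1Space) := by
    refine isSolution_iff.2 ⟨(G + E z).2, fun a ha haf => ?_, fun v hv hv0 => ?_⟩
    · rw [Submodule.coe_add, Pi.add_apply, hG a ha haf, hE0 z a ha haf, add_zero]
    · have h1 : B (G + E z) ⟨v, hv⟩ = F ⟨v, hv⟩ := by
        rw [hBexp _ _ hv0, hFexp _ hv0]
        refine Finset.sum_congr rfl fun i hi => ?_
        have h2 := congrFun hz ⟨i, hi⟩
        rw [hA] at h2
        rw [map_add, LinearMap.add_apply, h2]
        ring
      rwa [hB, hF] at h1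
  refine ⟨_, hsol, fun w hw x hx => ?_⟩
  obtain ⟨hw1, hw2, hw3⟩ := isSolution_iff.1 hw
  obtain ⟨-, hu2, hu3⟩ := isSolution_iff.1 hsol
  have h := hzero (⟨w, hw1⟩ - (G + E z)) (fun a ha haf => ?_) (fun v hv0 => ?_) x hx
  · exact sub_eq_zero.1 h
  · change w a - (G + E z : T.p1Space).1 a = 0
    rw [hw2 a ha haf, hu2 a ha haf, sub_self]
  · rw [map_sub, LinearMap.sub_apply, hB, hB, hw3 v v.2 hv0, hu3 v v.2 hv0, sub_self]

end Triangulation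

/-! ### The Laplacian and the Delaunay condition -/

/-- The angle in the Euclidean metric. -/
theorem metricAngle_one (x y : Plane) : metricAngle 1 x y = InnerProductGeometry.angle x y := by
  have hf : ∀ x y : Plane, form 1 x y = inner ℝ x y := by
    intro x y
    rw [form_eq]
    simp only [PiLp.inner_apply, Fin.sum_univ_two, RCLike.inner_apply, conj_trivial]
    simp
    ring
  rw [metricAngle, InnerProductGeometry.angle, hf, hf, hf, ← norm_eq_sqrt_real_inner,
    ← norm_eq_sqrt_real_inner]

/-- With C = 0 and unit determinants the arccot terms return the two angles, so θ is their sum,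
which is positive in any case. Continuity extends D = I, b = 0, c = 0 to the closure, so that the
averages and maxima over closed elements can be evaluated. -/
theorem Triangulation.edgeCondition_laplace {Ω : Set Plane} (T : Triangulation Ω)
    {D : Plane → Matrix (Fin 2) (Fin 2) ℝ} {b : Plane → Plane} {c : Plane → ℝ}
    (hD : ContinuousOn D (closure Ω)) (hb : ContinuousOn b (closure Ω))
    (hc : ContinuousOn c (closure Ω)) (h : ∀ x ∈ Ω, D x = 1 ∧ b x = 0 ∧ c x = 0)
    {i j k k' : Plane} (hedge : T.InternalEdge i j k k') :
    EdgeCondition D b c i j k k' ↔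
      EuclideanGeometry.angle i k j + EuclideanGeometry.angle i k' j ≤ Real.pi := by
  classical
  have hsc : Ω ⊆ closure Ω := _root_.subset_closure
  have hD1 : EqOn D (fun _ => 1) (closure Ω) :=
    EqOn.of_subset_closure (s := Ω) (fun x hx => (h x hx).1) hD continuousOn_const hsc subset_rfl
  have hb0 : EqOn b (fun _ => 0) (closure Ω) :=
    EqOn.of_subset_closure (s := Ω) (fun x hx => (h x hx).2.1) hb continuousOn_const hsc subset_rfl
  have hc0 : EqOn c (fun _ => 0) (closure Ω) :=
    EqOn.of_subset_closure (s := Ω) (fun x hx => (h x hx).2.2) hc continuousOn_const hsc subset_rfl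
  have key : ∀ l : Plane, (∃ K ∈ T.elems, (K : Set Plane) = {i, j, l}) →
      avg D (tri i j l) = 1 ∧ perturbation b c i j l = 0 ∧
        oppAngle D i j l = EuclideanGeometry.angle i l j ∧
        0 < EuclideanGeometry.angle i l j ∧ EuclideanGeometry.angle i l j < Real.pi := by
    rintro l ⟨K, hK, hKl⟩
    have htri : tri i j l = convexHull ℝ (K : Set Plane) := by rw [tri, hKl]
    have hsub : tri i j l ⊆ closure Ω := htri ▸ T.subset_closure hK
    have hne : (tri i j l).Nonempty := ⟨i, subset_convexHull ℝ _ (by simp)⟩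
    have hmeas : MeasurableSet (tri i j l) :=
      htri ▸ (IsTriangle.isCompact_convexHull K).isClosed.measurableSet
    have hvol : 0 < volume.real (tri i j l) := htri ▸ (T.isTriangle hK).area_pos
    have havg : avg D (tri i j l) = 1 := by
      ext r s
      simp only [avg, Matrix.of_apply, setAverage_eq]
      rw [setIntegral_congr_fun hmeas (g := fun _ => (1 : Matrix (Fin 2) (Fin 2) ℝ) r s)
        fun x hx => by simp only [hD1 (hsub hx)], setIntegral_const, smul_smul,
        inv_mul_cancel₀ hvol.ne', one_smul]
    have hopp : oppAngle D i j l = EuclideanGeometry.angle i l j := by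
      rw [oppAngle, havg, inv_one, metricAngle_one]
      rfl
    have hang := metricAngle_inv (P := 1) Matrix.PosDef.one ((T.isTriangle hK).cross_ne_zero hKl)
    rw [← havg] at hang
    change 0 < oppAngle D i j l ∧ oppAngle D i j l < Real.pi ∧ _ at hang
    rw [hopp] at hang
    refine ⟨havg, ?_, hopp, hang.1, hang.2.1⟩
    have h1 : (fun x => ‖b x‖) '' tri i j l = {0} := by
      rw [image_congr (g := fun _ => (0 : ℝ)) fun x hx => by rw [hb0 (hsub hx), norm_zero]]
      exact hne.image_const 0
    have h2 : c '' tri i j l = {0} := by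
      rw [image_congr (g := fun _ => (0 : ℝ)) fun x hx => hc0 (hsub hx)]
      exact hne.image_const 0
    rw [perturbation, h1, h2]
    simp
  obtain ⟨-, -, hK, hK'⟩ := hedge
  obtain ⟨h1, h2, h3, h4, h5⟩ := key k ⟨_, hK, by simp⟩
  obtain ⟨h1', h2', h3', h4', h5'⟩ := key k' ⟨_, hK', by simp⟩
  simp only [EdgeCondition, h1, h2, h3, h1', h2', h3', Matrix.det_one, div_one, Real.sqrt_one,
    one_mul, add_zero, mul_zero, sub_zero, arccot_cot h4 h5, arccot_cot h4' h5']
  constructor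
  · rintro ⟨-, hle⟩
    linarith
  · intro hle
    constructor <;> linarith

end P1FEM

theorem theorem4p2 (Ω : Set P1FEM.Plane) (hconn : IsConnected Ω)
    (hreg : interior (closure Ω) = Ω) (T : P1FEM.Triangulation Ω)
    (D : P1FEM.Plane → Matrix (Fin 2) (Fin 2) ℝ) (b : P1FEM.Plane → P1FEM.Plane)
    (c : P1FEM.Plane → ℝ)
    (hD : ContinuousOn D (closure Ω)) (hb : ContinuousOn b (closure Ω))
    (hb1 : ContDiffOn ℝ 1 b Ω) (hc : ContinuousOn c (closure Ω))
    (hDpos : ∀ x ∈ Ω, (D x).PosDef)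
    (hbc : ∀ x ∈ Ω, 0 ≤ c x - (1 / 2) * P1FEM.div b x)
    (hc0 : ∀ x ∈ Ω, 0 ≤ c x) :
    ((∀ i j k k' : P1FEM.Plane, T.InternalEdge i j k k' → P1FEM.EdgeCondition D b c i j k k') →
      P1FEM.UniquelySolvable T D b c ∧ P1FEM.SatisfiesDMP T D b c) ∧
    ((∀ x ∈ Ω, D x = 1 ∧ b x = 0 ∧ c x = 0) →
      ∀ i j k k' : P1FEM.Plane, T.InternalEdge i j k k' →
        (P1FEM.EdgeCondition D b c i j k k' ↔
          EuclideanGeometry.angle i k j + EuclideanGeometry.angle i k' j ≤ Real.pi)) := by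
  refine ⟨fun hedge => ⟨?_, ?_⟩, fun h i j k k' hedge => ?_⟩
  · exact P1FEM.Triangulation.uniquelySolvable hreg hD hb hb1 hc hDpos hbc hc0 hedge
  · exact P1FEM.Triangulation.satisfiesDMP hconn.nonempty hreg hD hb hb1 hc hDpos hbc hc0 hedge
  · exact T.edgeCondition_laplace hD hb hc h hedge
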